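/- Let $\Gamma$ be a finitely generated group and let $\mu$ be a finitely supported symmetric probability measure on $\Gamma$ (i.e. $\mu(x^{-1})=\mu(x)$ for all $x$) whose support generates $\Gamma$. For a field $K\in\{\mathbb{Q},\mathbb{R}\}$ equip the group algebra $K[\Gamma]$ with the involution $\xi^*(x)=\xi(x^{-1})$, and let $\Delta_\mu=1-\sum_{x\in\Gamma}\mu(x)\,x\in\mathbb{R}[\Gamma]$. (1) $\Gamma$ has Kazhdan's property (T) if and only if there are a real number $\kappa>0$ and a finite sequence $\xi_1,\dots,\xi_n\in\mathbb{R}[\Gamma]$ such that $$\Delta_\mu^2-\kappa\Delta_\mu=\sum_{i=1}^n\xi_i^*\xi_i .$$ (2) Suppose moreover that $\mu$ takes rational values, and let $\kappa>0$ be a rational number such that the spectrum of $\Delta_\mu$ in the full group $C^*$-algebra $C^*\Gamma$ is contained in $\{0\}\cup(\kappa,+\infty)$. Then there are $n\in\mathbb{N}$, positive rational numbers $r_1,\dots,r_n$ and $\xi_1,\dots,\xi_n\in\mathbb{Q}[\Gamma]$ such that $$\Delta_\mu^2-\kappa\Delta_\mu=\sum_{i=1}^n r_i\,\xi_i^*\xi_i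 .$$ Here $\Gamma$ has property (T) if there are a finite set $Q\subset\Gamma$ and $\varepsilon>0$ such that every unitary representation $\pi$ of $\Gamma$ on a complex Hilbert space having a vector $v\neq0$ with $\|\pi(g)v-v\|<\varepsilon\|v\|$ for all $g\in Q$ has a nonzero invariant vector; and $C^*\Gamma$ is the completion of $\mathbb{C}[\Gamma]$ for the norm $\|a\|=\sup_\pi\|\pi(a)\|$, the supremum being over all unitary representations $\pi$ of $\Gamma$ on complex Hilbert spaces. Empty sums ($n=0$) are allowed and equal $0$. -/

import Mathlib

universe u

/-- The `*`-operation `ξ*(x) = ξ(x⁻¹)` of a group algebra (used over `ℝ`, where the coefficients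
carry no conjugation). -/
noncomputable def groupStar {K G : Type*} [Semiring K] [Group G] (ξ : MonoidAlgebra K G) :
    MonoidAlgebra K G :=
  MonoidAlgebra.mapDomain (fun x : G => x⁻¹) ξ

/-- The Laplacian element `Δ_μ = 1 - ∑ x, μ(x) x` of `ℝ[Γ]`. -/
noncomputable def laplacian {G : Type*} [Group G] (μ : G →₀ ℝ) : MonoidAlgebra ℝ G :=
  1 - μ.sum fun x a => MonoidAlgebra.single x a

/-- Kazhdan's property (T) for a discrete group: there are a finite set `Q` and `ε > 0` such that
every unitary representation on a complex Hilbert space which has a `(Q, ε)`-invariant vector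
has a nonzero invariant vector. -/
def KazhdanPropertyT (G : Type u) [Group G] : Prop :=
  ∃ (Q : Finset G) (ε : ℝ), 0 < ε ∧
    ∀ (H : Type u) [NormedAddCommGroup H] [InnerProductSpace ℂ H] [CompleteSpace H]
      (π : G →* unitary (H →L[ℂ] H)),
      (∃ v : H, v ≠ 0 ∧ ∀ g ∈ Q, ‖(π g : H →L[ℂ] H) v - v‖ < ε * ‖v‖) →
        ∃ w : H, w ≠ 0 ∧ ∀ g : G, (π g : H →L[ℂ] H) w = w

/-- The linear extension of a unitary representation to the complex group algebra. -/
noncomputable def repExtend {G H : Type*} [Group G] [NormedAddCommGroup H] [InnerProductSpace ℂ H]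
    [CompleteSpace H] (π : G →* unitary (H →L[ℂ] H)) :
    MonoidAlgebra ℂ G →ₐ[ℂ] (H →L[ℂ] H) :=
  MonoidAlgebra.lift ℂ (H →L[ℂ] H) G ((unitary (H →L[ℂ] H)).subtype.comp π)

/-- The set of the norms `‖π(a)‖`, where `π` runs over the unitary representations of `G`. -/
def repNorms {G : Type u} [Group G] (a : MonoidAlgebra ℂ G) : Set ℝ :=
  {r | ∃ (H : Type u) (_ : NormedAddCommGroup H) (_ : InnerProductSpace ℂ H)
    (_ : CompleteSpace H) (π : G →* unitary (H →L[ℂ] H)), r = ‖repExtend π a‖}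

theorem norm_repExtend_le {G H : Type*} [Group G] [NormedAddCommGroup H] [InnerProductSpace ℂ H]
    [CompleteSpace H] (π : G →* unitary (H →L[ℂ] H)) (a : MonoidAlgebra ℂ G) :
    ‖repExtend π a‖ ≤ ∑ x ∈ a.coeff.support, ‖a.coeff x‖ := by
  rw [repExtend, MonoidAlgebra.lift_apply, Finsupp.sum]
  refine (norm_sum_le _ _).trans (Finset.sum_le_sum fun x _ => ?_)
  rw [norm_smul]
  refine mul_le_of_le_one_right (norm_nonneg _) ?_
  rcases subsingleton_or_nontrivial (H →L[ℂ] H) with h | h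
  · rw [Subsingleton.elim (((unitary (H →L[ℂ] H)).subtype.comp π) x) 0, norm_zero]
    exact zero_le_one
  · exact (CStarRing.norm_of_mem_unitary (π x).2).le

theorem bddAbove_repNorms {G : Type u} [Group G] (a : MonoidAlgebra ℂ G) :
    BddAbove (repNorms a) := by
  refine ⟨∑ x ∈ a.coeff.support, ‖a.coeff x‖, ?_⟩
  rintro r ⟨H, _, _, _, π, rfl⟩
  exact norm_repExtend_le π a

/-- The full (maximal) `C*`-seminorm `‖a‖ = sup_π ‖π(a)‖` on the complex group algebra. -/
noncomputable def fullNorm {G : Type u} [Group G] (a : MonoidAlgebra ℂ G) : ℝ :=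
  sSup (repNorms a)

theorem norm_le_fullNorm {G : Type u} [Group G] {H : Type u} [NormedAddCommGroup H]
    [InnerProductSpace ℂ H] [CompleteSpace H] (π : G →* unitary (H →L[ℂ] H))
    (a : MonoidAlgebra ℂ G) : ‖repExtend π a‖ ≤ fullNorm a :=
  le_csSup (bddAbove_repNorms a) ⟨H, _, _, _, π, rfl⟩

theorem fullNorm_nonneg {G : Type u} [Group G] (a : MonoidAlgebra ℂ G) : 0 ≤ fullNorm a :=
  Real.sSup_nonneg (by rintro r ⟨H, _, _, _, π, rfl⟩; exact norm_nonneg _)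

theorem fullNorm_le {G : Type u} [Group G] (a : MonoidAlgebra ℂ G) {C : ℝ} (hC : 0 ≤ C)
    (h : ∀ (H : Type u) [NormedAddCommGroup H] [InnerProductSpace ℂ H] [CompleteSpace H]
      (π : G →* unitary (H →L[ℂ] H)), ‖repExtend π a‖ ≤ C) : fullNorm a ≤ C :=
  Real.sSup_le (by rintro r ⟨H, _, _, _, π, rfl⟩; exact h H π) hC

/-- The full `C*`-seminorm as a ring seminorm. -/
noncomputable def fullRingSeminorm (G : Type u) [Group G] : RingSeminorm (MonoidAlgebra ℂ G) where
  toFun := fullNorm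
  map_zero' := le_antisymm (fullNorm_le _ le_rfl fun H _ _ _ π => by simp) (fullNorm_nonneg _)
  add_le' a b := fullNorm_le _ (add_nonneg (fullNorm_nonneg a) (fullNorm_nonneg b))
    fun H _ _ _ π => by
      rw [map_add]
      exact (norm_add_le _ _).trans (add_le_add (norm_le_fullNorm π a) (norm_le_fullNorm π b))
  neg' a := by simp only [fullNorm, repNorms, map_neg, norm_neg]
  mul_le' a b := fullNorm_le _ (mul_nonneg (fullNorm_nonneg a) (fullNorm_nonneg b))
    fun H _ _ _ π => by
      rw [map_mul]
      exact (norm_mul_le _ _).trans (mul_le_mul (norm_le_fullNorm π a) (norm_le_fullNorm π b)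
        (norm_nonneg _) (fullNorm_nonneg a))

/-- A copy of the complex group algebra, to be equipped with the full `C*`-seminorm. -/
def FullGroupAlgebra (G : Type u) [Group G] : Type u := MonoidAlgebra ℂ G

noncomputable instance (G : Type u) [Group G] : Ring (FullGroupAlgebra G) :=
  inferInstanceAs (Ring (MonoidAlgebra ℂ G))

noncomputable instance (G : Type u) [Group G] : Algebra ℂ (FullGroupAlgebra G) :=
  inferInstanceAs (Algebra ℂ (MonoidAlgebra ℂ G))

noncomputable instance (G : Type u) [Group G] : SeminormedRing (FullGroupAlgebra G) :=
  RingSeminorm.toSeminormedRing (R := FullGroupAlgebra G) (fullRingSeminorm G)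

noncomputable instance (G : Type u) [Group G] : NormedAlgebra ℂ (FullGroupAlgebra G) where
  norm_smul_le c a := fullNorm_le (G := G) _ (mul_nonneg (norm_nonneg c) (fullNorm_nonneg (G := G) a))
    fun H _ _ _ π => by
      have h : repExtend π (c • (show MonoidAlgebra ℂ G from a)) = c • repExtend π a := map_smul _ _ _
      exact (congrArg norm h).trans_le ((norm_smul_le _ _).trans
        (mul_le_mul_of_nonneg_left (norm_le_fullNorm π a) (norm_nonneg c)))

/-- The full group `C*`-algebra `C*(G)`: the (separated) completion of `ℂ[G]` for the full
`C*`-seminorm. -/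
abbrev FullGroupCStarAlgebra (G : Type u) [Group G] : Type u :=
  UniformSpace.Completion (FullGroupAlgebra G)

/-- The canonical map `ℝ[G] → ℂ[G] → C*(G)`. -/
noncomputable def toFullGroupCStarAlgebra {G : Type u} [Group G] (ξ : MonoidAlgebra ℝ G) :
    FullGroupCStarAlgebra G :=
  ((show FullGroupAlgebra G from MonoidAlgebra.mapRingHom G Complex.ofRealHom ξ :
    FullGroupAlgebra G) : UniformSpace.Completion (FullGroupAlgebra G))

/-! Sums of hermitian squares form a cone, and the Laplacian is an order unit for the hermitian
elements of augmentation zero: these are combinations of the elements `(1 - g)*(1 - g)`, and each of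
those is dominated by a multiple of the Laplacian because the support generates
(`exists_smul_edgeMap_sub_mem`). If such an element is not in the cone, it can be separated from it
by a positive functional, which amounts to a function `ψ` of conditionally negative type
(`exists_condNegative_of_notMem_sosCone`). By Schoenberg's theorem and the GNS construction, `exp
(-tψ)` is a matrix coefficient of a unitary representation. Differentiating at `t = 0` shows that
positivity in all representations gives membership in the cone up to an arbitrarily small multiple
of the Laplacian (`add_smul_edgeMap_mem_sosCone`).

Property (T), or the spectral hypothesis, makes `Δ² - κ'Δ` positive in every representation;
lowering `κ'` supplies the small multiple of `Δ`. Conversely, an algebraic identity bounds `Δ` below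
by `κ` in representations without invariant vectors, which excludes almost invariant ones.

For rational coefficients, the real squares are approximated by rational squares inside the
augmentation ideal, and the order unit over `ℚ` absorbs the error
(`add_smul_edgeMap_mem_sosCone_rat`). -/

/-! ### Involution, augmentation and edge Laplacians. -/

section GroupStar

variable {K G : Type*} [Field K] [Group G]

theorem groupStar_single (g : G) (a : K) :
    groupStar (MonoidAlgebra.single g a) = MonoidAlgebra.single g⁻¹ a :=
  MonoidAlgebra.mapDomain_single

theorem groupStar_zero : groupStar (0 : MonoidAlgebra K G) = 0 :=
  MonoidAlgebra.mapDomain_zero _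

theorem groupStar_add (ξ η : MonoidAlgebra K G) :
    groupStar (ξ + η) = groupStar ξ + groupStar η :=
  MonoidAlgebra.mapDomain_add _ _ _

/-- The `*`-operation as a linear map. -/
noncomputable def groupStarₗ (K G : Type*) [Field K] [Group G] :
    MonoidAlgebra K G →ₗ[K] MonoidAlgebra K G where
  toFun := groupStar
  map_add' := groupStar_add
  map_smul' c ξ := by
    induction ξ using MonoidAlgebra.induction_linear with
    | zero => simp [groupStar_zero]
    | add ξ η hξ hη => simp only [smul_add, groupStar_add, hξ, hη]
    | single g a => simp [groupStar_single, MonoidAlgebra.smul_single]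

theorem groupStar_smul (c : K) (ξ : MonoidAlgebra K G) : groupStar (c • ξ) = c • groupStar ξ :=
  (groupStarₗ K G).map_smul c ξ

theorem groupStar_sub (ξ η : MonoidAlgebra K G) :
    groupStar (ξ - η) = groupStar ξ - groupStar η :=
  (groupStarₗ K G).map_sub ξ η

theorem groupStar_sum {ι : Type*} (s : Finset ι) (f : ι → MonoidAlgebra K G) :
    groupStar (∑ i ∈ s, f i) = ∑ i ∈ s, groupStar (f i) :=
  map_sum (groupStarₗ K G) f s

theorem groupStar_one : groupStar (1 : MonoidAlgebra K G) = 1 := by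
  rw [MonoidAlgebra.one_def, groupStar_single, inv_one]

theorem groupStar_mul (ξ η : MonoidAlgebra K G) :
    groupStar (ξ * η) = groupStar η * groupStar ξ := by
  induction ξ using MonoidAlgebra.induction_linear with
  | zero => simp [groupStar_zero]
  | add ξ₁ ξ₂ h₁ h₂ => rw [add_mul, groupStar_add, h₁, h₂, groupStar_add, mul_add]
  | single g a =>
    induction η using MonoidAlgebra.induction_linear with
    | zero => simp [groupStar_zero]
    | add η₁ η₂ h₁ h₂ => rw [mul_add, groupStar_add, h₁, h₂, groupStar_add, add_mul]
    | single h b => simp [groupStar_single, MonoidAlgebra.single_mul_single, mul_comm]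

theorem groupStar_groupStar (ξ : MonoidAlgebra K G) : groupStar (groupStar ξ) = ξ := by
  induction ξ using MonoidAlgebra.induction_linear with
  | zero => simp [groupStar_zero]
  | add ξ η hξ hη => simp only [groupStar_add, hξ, hη]
  | single g a => simp [groupStar_single]

theorem groupStar_coeff (ξ : MonoidAlgebra K G) (g : G) :
    (groupStar ξ).coeff g = ξ.coeff g⁻¹ := by
  have h := Finsupp.mapDomain_apply inv_injective ξ.coeff (g⁻¹ : G)
  rwa [inv_inv] at h

theorem groupStar_mapRingHom {L : Type*} [Field L] (f : K →+* L) (ξ : MonoidAlgebra K G) :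
    groupStar (MonoidAlgebra.mapRingHom G f ξ) = MonoidAlgebra.mapRingHom G f (groupStar ξ) := by
  ext g
  simp [groupStar_coeff]

/-- The augmentation homomorphism `ξ ↦ ∑ ξ(x)`. -/
noncomputable def augmentation (K G : Type*) [Field K] [Group G] : MonoidAlgebra K G →ₐ[K] K :=
  MonoidAlgebra.lift K K G 1

theorem augmentation_single (g : G) (a : K) :
    augmentation K G (MonoidAlgebra.single g a) = a := by
  simp [augmentation]

theorem augmentation_eq_sum (ξ : MonoidAlgebra K G) :
    augmentation K G ξ = ξ.coeff.sum fun _ a => a := by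
  simp [augmentation, MonoidAlgebra.lift_apply]

theorem augmentation_groupStar (ξ : MonoidAlgebra K G) :
    augmentation K G (groupStar ξ) = augmentation K G ξ := by
  induction ξ using MonoidAlgebra.induction_linear with
  | zero => simp [groupStar_zero]
  | add ξ η hξ hη => simp only [groupStar_add, map_add, hξ, hη]
  | single g a => simp [groupStar_single, augmentation_single]

/-- The element `(1 - g)*(1 - g) = 2 - g - g⁻¹` of a group algebra. -/
noncomputable def edgeLaplacian (K : Type*) {G : Type*} [Field K] [Group G] (g : G) :
    MonoidAlgebra K G :=
  groupStar (1 - MonoidAlgebra.single g 1) * (1 - MonoidAlgebra.single g 1)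

theorem edgeLaplacian_eq (g : G) :
    edgeLaplacian K g = (2 : K) • (1 : MonoidAlgebra K G) - MonoidAlgebra.single g 1
      - MonoidAlgebra.single g⁻¹ 1 := by
  rw [edgeLaplacian, groupStar_sub, groupStar_one, groupStar_single, sub_mul, one_mul, mul_sub,
    mul_one, MonoidAlgebra.single_mul_single, inv_mul_cancel, mul_one, ← MonoidAlgebra.one_def,
    two_smul]
  abel

theorem edgeLaplacian_inv (g : G) : edgeLaplacian K g⁻¹ = edgeLaplacian K g := by
  rw [edgeLaplacian_eq, edgeLaplacian_eq, inv_inv]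
  abel

theorem edgeLaplacian_one : edgeLaplacian K (1 : G) = 0 := by
  rw [edgeLaplacian, ← MonoidAlgebra.one_def, sub_self, mul_zero]

/-- The linear map `δ_g ↦ (1 - g)*(1 - g)`. -/
noncomputable def edgeMap (K G : Type*) [Field K] [Group G] :
    (G →₀ K) →ₗ[K] MonoidAlgebra K G :=
  Finsupp.linearCombination K (edgeLaplacian K)

theorem edgeMap_single (g : G) (a : K) :
    edgeMap K G (Finsupp.single g a) = a • edgeLaplacian K g :=
  Finsupp.linearCombination_single K a g

theorem edgeMap_eq (w : G →₀ K) :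
    edgeMap K G w = (2 * augmentation K G (.ofCoeff w)) • (1 : MonoidAlgebra K G) - .ofCoeff w
      - groupStar (.ofCoeff w) := by
  induction w using Finsupp.induction_linear with
  | zero => simp [groupStar_zero]
  | add v w hv hw =>
    rw [map_add, hv, hw, MonoidAlgebra.ofCoeff_add, map_add, groupStar_add, mul_add, add_smul]
    abel
  | single g a =>
    rw [edgeMap_single, edgeLaplacian_eq, MonoidAlgebra.ofCoeff_single, augmentation_single,
      groupStar_single, smul_sub, smul_sub, smul_smul, mul_comm a 2]
    simp [MonoidAlgebra.smul_single]

/-- In `edgeMap_eq` the constant term vanishes and the other two coincide, leaving `-2x`. So every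
hermitian element of augmentation zero is a combination of edge Laplacians. -/
theorem edgeMap_coeff [CharZero K] {x : MonoidAlgebra K G} (hx : groupStar x = x)
    (hx₀ : augmentation K G x = 0) : edgeMap K G ((-1 / 2 : K) • x.coeff) = x := by
  rw [map_smul, edgeMap_eq, MonoidAlgebra.ofCoeff_coeff, hx, hx₀, mul_zero, zero_smul, zero_sub,
    ← neg_add', smul_neg, ← two_smul K x, smul_smul, ← neg_smul]
  norm_num

theorem edgeMap_probability [CharZero K] {μ : G →₀ K} (hsum : (μ.sum fun _ a => a) = 1)
    (hsymm : ∀ x, μ x⁻¹ = μ x) :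
    edgeMap K G μ = (2 : K) • (1 - MonoidAlgebra.ofCoeff μ : MonoidAlgebra K G) := by
  have h : groupStar (MonoidAlgebra.ofCoeff μ) = MonoidAlgebra.ofCoeff μ := by
    ext g
    rw [groupStar_coeff]
    exact hsymm g
  rw [edgeMap_eq, h, augmentation_eq_sum, MonoidAlgebra.coeff_ofCoeff, hsum, mul_one, smul_sub,
    two_smul K (MonoidAlgebra.ofCoeff μ), sub_sub]

end GroupStar

/-! ### The cone of hermitian squares, with the Laplacian as order unit. -/

section Cone

variable (K G : Type*) [Field K] [LinearOrder K] [IsStrictOrderedRing K] [Group G]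

/-- The cone of sums of hermitian squares in a group algebra over an ordered field. -/
noncomputable def sosCone : PointedCone K (MonoidAlgebra K G) :=
  PointedCone.hull K (Set.range fun ξ : MonoidAlgebra K G => groupStar ξ * ξ)

variable {K G}

theorem groupStar_mul_self_mem (ξ : MonoidAlgebra K G) : groupStar ξ * ξ ∈ sosCone K G :=
  PointedCone.subset_hull ⟨ξ, rfl⟩

theorem smul_mem_sosCone {c : K} (hc : 0 ≤ c) {x : MonoidAlgebra K G} (hx : x ∈ sosCone K G) :
    c • x ∈ sosCone K G :=
  (sosCone K G).smul_mem hc hx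

theorem exists_sum_of_mem_sosCone {x : MonoidAlgebra K G} (hx : x ∈ sosCone K G) :
    ∃ (n : ℕ) (r : Fin n → K) (ξ : Fin n → MonoidAlgebra K G), (∀ i, 0 < r i) ∧
      x = ∑ i, r i • (groupStar (ξ i) * ξ i) := by
  obtain ⟨n, f, g, rfl⟩ := Submodule.mem_span_set'.1 hx
  choose ξ hξ using fun i => (g i).2
  -- Strict positivity of the weights: a term of weight `0` becomes the square of `0` with weight
  -- `1`.
  refine ⟨n, fun i => if (f i : K) = 0 then 1 else f i, fun i => if (f i : K) = 0 then 0 else ξ i,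
    fun i => ?_, Finset.sum_congr rfl fun i _ => ?_⟩
  · dsimp only
    split_ifs with h
    · exact one_pos
    · exact lt_of_le_of_ne (f i).2 (Ne.symm h)
  · rw [← hξ i]
    dsimp only
    split_ifs with h
    · rw [Nonneg.mk_smul (f i).1 (f i).2, h]
      simp
    · rfl

theorem edgeLaplacian_mem (g : G) : edgeLaplacian K g ∈ sosCone K G :=
  groupStar_mul_self_mem _

theorem edgeMap_mem {w : G →₀ K} (hw : ∀ g, 0 ≤ w g) : edgeMap K G w ∈ sosCone K G := by
  rw [edgeMap, Finsupp.linearCombination_apply]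
  exact Submodule.sum_mem _ fun g _ => smul_mem_sosCone (hw g) (edgeLaplacian_mem g)

/-- Parallelogram law for `a = 1 - g` and `b = g(1 - h)`: here `a + b = 1 - gh` and `b*b = (1 -
h)*(1 - h)`, so the difference is `(a - b)*(a - b)`. -/
theorem two_smul_add_sub_edgeLaplacian_mul_mem (g h : G) :
    (2 : K) • (edgeLaplacian K g + edgeLaplacian K h) - edgeLaplacian K (g * h) ∈
      sosCone K G := by
  convert groupStar_mul_self_mem
    (1 - MonoidAlgebra.single g (1 : K) - MonoidAlgebra.single g 1 * (1 - MonoidAlgebra.single h 1))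
    using 1
  simp only [edgeLaplacian, groupStar_sub, groupStar_single, mul_sub,
    sub_mul, mul_one, one_mul, MonoidAlgebra.single_mul_single, mul_inv_rev, MonoidAlgebra.one_def,
    inv_mul_cancel, two_smul, inv_mul_cancel_left, mul_assoc, inv_one]
  abel

/-- Every `(1 - g)*(1 - g)` is dominated by a multiple of `∑ w(x) (1 - x)*(1 - x)` when the support
of `w` generates the group. -/
theorem exists_smul_edgeMap_sub_mem {w : G →₀ K} (hw : ∀ g, 0 ≤ w g)
    (hgen : Subgroup.closure {x : G | w x ≠ 0} = ⊤) (g : G) :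
    ∃ C : K, 0 ≤ C ∧ C • edgeMap K G w - edgeLaplacian K g ∈ sosCone K G := by
  have hg : g ∈ Subgroup.closure {x : G | w x ≠ 0} := hgen ▸ Subgroup.mem_top g
  induction hg using Subgroup.closure_induction with
  | mem s hs =>
    refine ⟨(w s)⁻¹, inv_nonneg.2 (hw s), ?_⟩
    -- The term at `s` cancels; the remaining weights are nonnegative.
    have h : (w s)⁻¹ • edgeMap K G w - edgeLaplacian K s =
        (w s)⁻¹ • edgeMap K G (w.erase s) := by
      conv_lhs => rw [← Finsupp.single_add_erase s w]
      rw [map_add, edgeMap_single, smul_add, smul_smul]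
      simp [inv_mul_cancel₀ hs]
    rw [h]
    refine smul_mem_sosCone (inv_nonneg.2 (hw s)) (edgeMap_mem fun g => ?_)
    classical
    rw [Finsupp.erase_apply]
    split_ifs
    exacts [le_rfl, hw g]
  | one => exact ⟨0, le_rfl, by simp [edgeLaplacian_one]⟩
  | mul g h _ _ hg hh =>
    obtain ⟨C, hC, hCg⟩ := hg
    obtain ⟨D, hD, hDh⟩ := hh
    refine ⟨2 * (C + D), by positivity, ?_⟩
    convert add_mem (smul_mem_sosCone zero_le_two (add_mem hCg hDh))
      (two_smul_add_sub_edgeLaplacian_mul_mem (K := K) g h) using 1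
    simp only [mul_smul, add_smul, smul_add, smul_sub]
    abel
  | inv g _ hg => simpa only [edgeLaplacian_inv] using hg

/-- Termwise, only negative coefficients need compensation by `D`. The explicit weighted `ℓ¹` bound
is what later makes a rational approximation error absorbable. -/
theorem edgeMap_add_smul_mem {D : MonoidAlgebra K G} {C : G → K} (hD : D ∈ sosCone K G)
    (hC₀ : ∀ g, 0 ≤ C g) (hC : ∀ g, C g • D - edgeLaplacian K g ∈ sosCone K G) (w : G →₀ K) :
    edgeMap K G w + (w.sum fun g a => |a| * C g) • D ∈ sosCone K G := by
  rw [edgeMap, Finsupp.linearCombination_apply, Finsupp.sum, Finsupp.sum, Finset.sum_smul,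
    ← Finset.sum_add_distrib]
  refine Submodule.sum_mem _ fun g _ => ?_
  rcases le_total 0 (w g) with h | h
  · exact add_mem (smul_mem_sosCone h (edgeLaplacian_mem g))
      (smul_mem_sosCone (mul_nonneg (abs_nonneg _) (hC₀ g)) hD)
  · convert smul_mem_sosCone (neg_nonneg.2 h) (hC g) using 1
    rw [abs_of_nonpos h, smul_sub, smul_smul, neg_smul _ (edgeLaplacian K g)]
    abel

end Cone

/-- Separation of a point from a cone with an order unit. -/
theorem PointedCone.exists_linearMap_of_notMem {E : Type*} [AddCommGroup E] [Module ℝ E]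
    (s : PointedCone ℝ E) {x e : E} (hx : x ∉ s) (he : e ∈ s)
    (hunit : ∀ y, ∃ c : ℝ, y + c • e ∈ s) :
    ∃ φ : E →ₗ[ℝ] ℝ, (∀ y ∈ s, 0 ≤ φ y) ∧ φ x ≤ 0 ∧ φ e = 1 := by
  have he₀ : e ≠ 0 := by
    rintro rfl
    obtain ⟨c, hc⟩ := hunit x
    exact hx (by simpa using hc)
  -- Otherwise all real multiples of `e` lie in `s`, and the order unit property puts `x` there too.
  have hneg : ∀ t : ℝ, t < 0 → t • e ∉ s := fun t ht hte => by
    obtain ⟨c, hc⟩ := hunit x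
    apply hx
    rcases le_total 0 c with h | h
    · have h' := add_mem hc (s.smul_mem (div_nonneg h (neg_nonneg.2 ht.le)) hte)
      rwa [smul_smul, div_neg, neg_mul, div_mul_cancel₀ c ht.ne, neg_smul, add_neg_cancel_right]
        at h'
    · have h' := add_mem hc (s.smul_mem (neg_nonneg.2 h) he)
      rwa [neg_smul, add_neg_cancel_right] at h'
  -- The functional `t • e ↦ t` is extended positively. Adjoining `-x` to the cone forces `φ x ≤ 0`;
  -- it stays nonnegative on the line because `y - a • x = t • e` with `y ∈ s`, `t < 0` and `a > 0`
  -- would express `x` as an element of `s`.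
  obtain ⟨φ, hφ, hφs⟩ := riesz_extension (s ⊔ PointedCone.hull ℝ {-x})
    (LinearPMap.mkSpanSingleton e (1 : ℝ) he₀) (by
      rintro ⟨z, hz⟩ hzs
      obtain ⟨t, rfl⟩ := Submodule.mem_span_singleton.1 hz
      obtain ⟨y, hy, w, hw, hyw⟩ := Submodule.mem_sup.1 hzs
      obtain ⟨a, rfl⟩ := Submodule.mem_span_singleton.1 hw
      refine le_of_le_of_eq ?_ (LinearPMap.mkSpanSingleton'_apply e (1 : ℝ) _ t hz).symm
      rw [smul_eq_mul, mul_one, RingHom.id_apply]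
      by_contra! ht
      replace hyw : y + a • -x = t • e := hyw
      have hyw' : y = t • e + (a : ℝ) • x := by
        rw [← hyw]
        change y = y + (a : ℝ) • -x + (a : ℝ) • x
        rw [smul_neg, neg_add_cancel_right]
      rcases a.2.eq_or_lt with ha | ha
      · rw [← ha, zero_smul, add_zero] at hyw'
        exact hneg t ht (hyw' ▸ hy)
      · apply hx
        have h := s.smul_mem (inv_nonneg.2 ha.le)
          (add_mem hy (s.smul_mem (neg_nonneg.2 ht.le) he))
        rwa [hyw', neg_smul, add_neg_cancel_comm, smul_smul, inv_mul_cancel₀ ha.ne', one_smul] at h)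
    (fun y => by
      obtain ⟨c, hc⟩ := hunit y
      exact ⟨⟨c • e, Submodule.mem_span_singleton.2 ⟨c, rfl⟩⟩,
        Submodule.mem_sup_left (by rwa [add_comm])⟩)
  refine ⟨φ, fun y hy => hφs y (Submodule.mem_sup_left hy), ?_, ?_⟩
  · have h := hφs (-x) (Submodule.mem_sup_right (PointedCone.subset_hull rfl))
    rwa [map_neg, neg_nonneg] at h
  · have h := hφ ⟨(1 : ℝ) • e, Submodule.mem_span_singleton.2 ⟨1, rfl⟩⟩
    erw [LinearPMap.mkSpanSingleton'_apply] at h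
    simpa using h

/-! ### Functions on the group as functionals on the group algebra. -/

section Pairing

variable {K G : Type*} [Field K]

/-- The linear functional `ξ ↦ ∑ ξ(x) f(x)` on a group algebra. -/
noncomputable def pairing (f : G → K) : MonoidAlgebra K G →ₗ[K] K where
  toFun ξ := Finsupp.linearCombination K f ξ.coeff
  map_add' ξ η := by rw [MonoidAlgebra.coeff_add, map_add]
  map_smul' c ξ := by rw [MonoidAlgebra.coeff_smul, map_smul]; rfl

theorem pairing_apply (f : G → K) (ξ : MonoidAlgebra K G) :
    pairing f ξ = ξ.coeff.sum fun g a => a * f g :=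
  Finsupp.linearCombination_apply K _

theorem pairing_single (f : G → K) (g : G) (a : K) :
    pairing f (MonoidAlgebra.single g a) = a * f g :=
  Finsupp.linearCombination_single K a g

variable [Group G]

theorem pairing_groupStar {f : G → K} (hf : ∀ g, f g⁻¹ = f g) (ξ : MonoidAlgebra K G) :
    pairing f (groupStar ξ) = pairing f ξ := by
  induction ξ using MonoidAlgebra.induction_linear with
  | zero => simp [groupStar_zero]
  | add ξ η hξ hη => simp only [groupStar_add, map_add, hξ, hη]
  | single g a => rw [groupStar_single, pairing_single, pairing_single, hf]

theorem pairing_groupStar_mul (f : G → K) (ξ η : MonoidAlgebra K G) :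
    pairing f (groupStar ξ * η) =
      ξ.coeff.sum fun g a => η.coeff.sum fun h b => a * b * f (g⁻¹ * h) := by
  induction ξ using MonoidAlgebra.induction_linear with
  | zero => simp [groupStar_zero]
  | add ξ₁ ξ₂ h₁ h₂ =>
    rw [groupStar_add, add_mul, map_add, h₁, h₂, MonoidAlgebra.coeff_add,
      Finsupp.sum_add_index' (by simp) (by simp [add_mul, Finsupp.sum_add])]
  | single g a =>
    rw [MonoidAlgebra.coeff_single, Finsupp.sum_single_index (by simp), groupStar_single]
    induction η using MonoidAlgebra.induction_linear with
    | zero => simp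
    | add η₁ η₂ h₁ h₂ =>
      rw [mul_add, map_add, h₁, h₂, MonoidAlgebra.coeff_add,
        Finsupp.sum_add_index' (by simp) (by simp [add_mul, mul_add])]
    | single h b =>
      rw [MonoidAlgebra.single_mul_single, pairing_single, MonoidAlgebra.coeff_single,
        Finsupp.sum_single_index (by simp)]

end Pairing

/-- A hermitian element of the augmentation ideal which is not a sum of hermitian squares is
detected by a function of conditionally negative type. -/
theorem exists_condNegative_of_notMem_sosCone {G : Type*} [Group G] {w : G →₀ ℝ}
    (hw : ∀ g, 0 ≤ w g) (hgen : Subgroup.closure {x : G | w x ≠ 0} = ⊤)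
    {x : MonoidAlgebra ℝ G} (hx : groupStar x = x) (hx₀ : augmentation ℝ G x = 0)
    (hxs : x ∉ sosCone ℝ G) :
    ∃ ψ : G → ℝ, ψ 1 = 0 ∧ (∀ g, ψ g⁻¹ = ψ g) ∧
      (∀ ξ : MonoidAlgebra ℝ G, augmentation ℝ G ξ = 0 → pairing ψ (groupStar ξ * ξ) ≤ 0) ∧
      0 ≤ pairing ψ x ∧ pairing ψ (.ofCoeff w) = 1 := by
  -- Separating after pulling back along `edgeMap` yields a functional on all finitely supported
  -- functions; its values at point masses are `ψ`.
  let s : PointedCone ℝ (G →₀ ℝ) := (sosCone ℝ G).comap (edgeMap ℝ G)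
  have hs : ∀ v, v ∈ s ↔ edgeMap ℝ G v ∈ sosCone ℝ G := fun v => Iff.rfl
  choose C hC₀ hC using exists_smul_edgeMap_sub_mem hw hgen
  obtain ⟨φ, hφ, hφx, hφw⟩ := s.exists_linearMap_of_notMem (x := (-1 / 2 : ℝ) • x.coeff) (e := w)
    (by rwa [hs, edgeMap_coeff hx hx₀]) (edgeMap_mem hw) fun v =>
      ⟨_, (hs _).2 (by
        rw [map_add, map_smul]
        exact edgeMap_add_smul_mem (edgeMap_mem hw) hC₀ hC v)⟩
  -- The kernel lies in `s` together with its negatives. This gives `ψ 1 = 0` and the symmetry of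
  -- `ψ`.
  have hker : ∀ v, edgeMap ℝ G v = 0 → φ v = 0 := fun v hv => by
    refine le_antisymm (neg_nonneg.1 ?_) (hφ v (by rw [hs, hv]; exact zero_mem _))
    rw [← map_neg]
    exact hφ _ (by rw [hs, map_neg, hv, neg_zero]; exact zero_mem _)
  have hpair : ∀ v, pairing (fun g => φ (Finsupp.single g 1)) (.ofCoeff v) = φ v := fun v => by
    induction v using Finsupp.induction_linear with
    | zero => simp
    | add v w hv hw => rw [MonoidAlgebra.ofCoeff_add, map_add, map_add, hv, hw]
    | single g a =>
      rw [MonoidAlgebra.ofCoeff_single, pairing_single, ← smul_eq_mul, ← map_smul,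
        Finsupp.smul_single_one]
  refine ⟨fun g => φ (Finsupp.single g 1), hker _ ?_, fun g => ?_, fun ξ hξ => ?_, ?_, ?_⟩
  · rw [edgeMap_single, edgeLaplacian_one, smul_zero]
  · rw [← sub_eq_zero, ← map_sub]
    refine hker _ ?_
    rw [map_sub, edgeMap_single, edgeMap_single, edgeLaplacian_inv, sub_self]
  · have h := hφ ((-1 / 2 : ℝ) • (groupStar ξ * ξ).coeff) (by
      rw [hs, edgeMap_coeff (by rw [groupStar_mul, groupStar_groupStar])
        (by rw [map_mul, hξ, mul_zero])]
      exact groupStar_mul_self_mem ξ)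
    rw [← hpair, MonoidAlgebra.ofCoeff_smul, map_smul, MonoidAlgebra.ofCoeff_coeff,
      smul_eq_mul] at h
    linarith
  · rw [← hpair, MonoidAlgebra.ofCoeff_smul, map_smul, MonoidAlgebra.ofCoeff_coeff,
      smul_eq_mul] at hφx
    linarith
  · rw [hpair, hφw]

/-! ### Schoenberg's theorem. -/

section Schoenberg

open Matrix

/-- The entrywise exponential of a positive semidefinite kernel is positive semidefinite. -/
theorem Matrix.PosSemidef.map_exp {ι : Type*} {N : Matrix ι ι ℝ} (hN : N.PosSemidef) :
    (N.map Real.exp).PosSemidef := by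
  -- Schur product theorem for the entrywise powers; the exponential is then summed from its power
  -- series.
  have hpow : ∀ n : ℕ, (N.map (· ^ n)).PosSemidef := fun n => by
    induction n with
    | zero =>
      refine ⟨by ext; simp, fun x => ?_⟩
      have h : (x.sum fun i a => x.sum fun j b => star a * N.map (· ^ 0) i j * b) =
          (x.sum fun _ a => a) * x.sum fun _ a => a := by
        simp [Finsupp.sum, Finset.sum_mul_sum]
      rw [h]
      exact mul_self_nonneg _
    | succ n ih =>
      have h : N.map (· ^ (n + 1)) = N.map (· ^ n) ⊙ N := by
        ext i j
        simp [pow_succ]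
      exact h ▸ ih.hadamard hN
  refine ⟨by ext i j; simpa using congrArg Real.exp (hN.1.apply i j), fun x => ?_⟩
  have hsum : HasSum (fun n : ℕ => (n.factorial : ℝ)⁻¹ *
      x.sum fun i a => x.sum fun j b => star a * N.map (· ^ n) i j * b)
      (x.sum fun i a => x.sum fun j b => star a * N.map Real.exp i j * b) := by
    simp only [Finsupp.sum, Finset.mul_sum]
    refine hasSum_sum fun i _ => hasSum_sum fun j _ => ?_
    have h := NormedSpace.expSeries_div_hasSum_exp (N i j)
    rw [← Real.exp_eq_exp_ℝ] at h
    have h' : (fun n : ℕ => (n.factorial : ℝ)⁻¹ * (star (x i) * N.map (· ^ n) i j * x j)) =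
        fun n => star (x i) * (N i j ^ n / n.factorial) * x j :=
      funext fun n => by rw [map_apply]; ring
    rw [h']
    exact (h.mul_left (star (x i))).mul_right (x j)
  have hn : ∀ n : ℕ, 0 ≤ (n.factorial : ℝ)⁻¹ *
      x.sum fun i a => x.sum fun j b => star a * N.map (· ^ n) i j * b := fun n => by
    have h := (hpow n).2 x
    positivity
  exact hsum.nonneg hn

/-- A real positive semidefinite kernel is positive semidefinite over `ℂ`. -/
theorem Matrix.PosSemidef.map_complex_ofReal {ι : Type*} {N : Matrix ι ι ℝ} (hN : N.PosSemidef)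
    (x : ι →₀ ℂ) :
    0 ≤ (x.sum fun i a => x.sum fun j b => star a * (N i j : ℂ) * b).re := by
  classical
  -- The real part of the complex form is the sum of the real forms at the real and imaginary parts
  -- of `x`.
  have hre : ∀ y : ι → ℝ, 0 ≤ ∑ i ∈ x.support, ∑ j ∈ x.support, y i * N i j * y j := fun y => by
    have h := (hN.submatrix ((↑) : x.support → ι)).dotProduct_mulVec_nonneg (fun i => y i)
    simp only [dotProduct, mulVec, Finset.mul_sum, submatrix_apply, Pi.star_apply, star_trivial,
      ← mul_assoc] at h
    rw [Finset.sum_coe_sort x.support fun i => ∑ j : x.support, y i * N i j * y j] at h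
    refine h.trans_eq (Finset.sum_congr rfl fun i _ => ?_)
    exact Finset.sum_coe_sort x.support fun j => y i * N i j * y j
  have h := add_nonneg (hre fun i => (x i).re) (hre fun i => (x i).im)
  refine h.trans_eq ?_
  simp only [Finsupp.sum, Complex.re_sum, ← Finset.sum_add_distrib]
  refine Finset.sum_congr rfl fun i _ => Finset.sum_congr rfl fun j _ => ?_
  simp

/-- **Schoenberg's theorem**: if `ψ` is of conditionally negative type, then `exp (-tψ)` is of
positive type. -/
theorem posSemidef_exp_neg {G : Type*} [Group G] {ψ : G → ℝ} (h₁ : ψ 1 = 0)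
    (hinv : ∀ g, ψ g⁻¹ = ψ g)
    (hψ : ∀ ξ : MonoidAlgebra ℝ G, augmentation ℝ G ξ = 0 → pairing ψ (groupStar ξ * ξ) ≤ 0)
    {t : ℝ} (ht : 0 ≤ t) :
    (Matrix.of fun g h : G => Real.exp (-(t * ψ (g⁻¹ * h)))).PosSemidef := by
  have hN : (Matrix.of fun g h : G => ψ g + ψ h - ψ (g⁻¹ * h)).PosSemidef := by
    refine ⟨?_, fun x => ?_⟩
    · ext g h
      simp only [conjTranspose_apply, of_apply, star_trivial]
      rw [← hinv (g⁻¹ * h), _root_.mul_inv_rev, inv_inv, add_comm (ψ h)]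
    · set X : MonoidAlgebra ℝ G := .ofCoeff x with hX
      set a := augmentation ℝ G X with ha
      -- Correcting at the identity gives augmentation zero; as `ψ 1 = 0`, the cross terms produce
      -- exactly `ψ g + ψ h`.
      have h := hψ (X - a • 1) (by rw [map_sub, map_smul, map_one, smul_eq_mul, mul_one, sub_self])
      have h_one : pairing ψ (1 : MonoidAlgebra ℝ G) = 0 := by
        rw [MonoidAlgebra.one_def, pairing_single, h₁, mul_zero]
      rw [groupStar_sub, groupStar_smul, groupStar_one, sub_mul, mul_sub, mul_sub, smul_one_mul,
        smul_one_mul, mul_smul_one, map_sub, map_sub, map_sub, map_smul, map_smul, map_smul,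
        map_smul, pairing_groupStar hinv, h_one, pairing_groupStar_mul, pairing_apply ψ X] at h
      rw [augmentation_eq_sum] at ha
      have hsum : (x.sum fun g c => x.sum fun h d =>
          star c * (Matrix.of fun g h : G => ψ g + ψ h - ψ (g⁻¹ * h)) g h * d) =
          2 * (a * x.sum fun g c => c * ψ g) -
            x.sum fun g c => x.sum fun h d => c * d * ψ (g⁻¹ * h) := by
        rw [ha, two_mul]
        nth_rewrite 1 [mul_comm]
        simp only [hX, MonoidAlgebra.coeff_ofCoeff, Finsupp.sum, Finset.sum_mul_sum,
          ← Finset.sum_add_distrib, ← Finset.sum_sub_distrib, star_trivial, of_apply]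
        exact Finset.sum_congr rfl fun i _ => Finset.sum_congr rfl fun j _ => by ring
      rw [hsum]
      simp only [smul_eq_mul, mul_zero, sub_zero, hX, MonoidAlgebra.coeff_ofCoeff] at h
      linarith
  have hexp := (hN.smul ht).map_exp
  have hrank : (Matrix.of fun g h : G => Real.exp (-(t * ψ g)) * Real.exp (-(t * ψ h))).PosSemidef := by
    refine ⟨by ext g h; simp [mul_comm], fun x => ?_⟩
    have h : (x.sum fun i a => x.sum fun j b => star a *
        (Matrix.of fun g h : G => Real.exp (-(t * ψ g)) * Real.exp (-(t * ψ h))) i j * b) =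
          (x.sum fun g a => a * Real.exp (-(t * ψ g))) *
            x.sum fun g a => a * Real.exp (-(t * ψ g)) := by
      simp only [Finsupp.sum, Finset.sum_mul_sum, star_trivial, of_apply]
      exact Finset.sum_congr rfl fun i _ => Finset.sum_congr rfl fun j _ => by ring
    rw [h]
    exact mul_self_nonneg _
  -- Schur product of a rank-one kernel with the exponential of the kernel `hN`.
  have h : (Matrix.of fun g h : G => Real.exp (-(t * ψ (g⁻¹ * h)))) =
      (Matrix.of fun g h : G => Real.exp (-(t * ψ g)) * Real.exp (-(t * ψ h))) ⊙
        (t • Matrix.of fun g h : G => ψ g + ψ h - ψ (g⁻¹ * h)).map Real.exp := by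
    ext g h
    simp only [of_apply, hadamard_apply, map_apply, Matrix.smul_apply, smul_eq_mul, ← Real.exp_add]
    congr 1
    ring
  exact h ▸ hrank.hadamard hexp

end Schoenberg

/-! ### The GNS construction. -/

section GNS

open Matrix UniformSpace Completion
open scoped InnerProductSpace ComplexConjugate

/-- The **Gelfand–Naimark–Segal construction** for a real function of positive type on a group. -/
theorem exists_unitaryRep_of_posSemidef {G : Type u} [Group G] {f : G → ℝ}
    (hf : (Matrix.of fun g h : G => f (g⁻¹ * h)).PosSemidef) :
    ∃ (H : Type u) (_ : NormedAddCommGroup H) (_ : InnerProductSpace ℂ H) (_ : CompleteSpace H)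
      (π : G →* unitary (H →L[ℂ] H)) (v : H),
      ∀ g, ⟪v, (π g : H →L[ℂ] H) v⟫_ℂ = (f g : ℂ) := by
  have hsymm : ∀ g h : G, f (h⁻¹ * g) = f (g⁻¹ * h) := fun g h => by
    simpa using hf.1.apply g h
  -- The form may be degenerate; null vectors disappear in the separated completion.
  let core : PreInnerProductSpace.Core ℂ (G →₀ ℂ) :=
    { inner := fun ξ η => ξ.sum fun g a => η.sum fun h b => conj a * (f (g⁻¹ * h) : ℂ) * b
      conj_inner_symm := fun ξ η => by
        simp only [Finsupp.sum, map_sum, map_mul, Complex.conj_conj, Complex.conj_ofReal]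
        rw [Finset.sum_comm]
        refine Finset.sum_congr rfl fun g _ => Finset.sum_congr rfl fun h _ => ?_
        rw [hsymm]
        ring
      re_inner_nonneg := fun ξ => hf.map_complex_ofReal ξ
      add_left := fun ξ₁ ξ₂ η =>
        Finsupp.sum_add_index' (by simp) (by simp [add_mul, Finsupp.sum_add])
      smul_left := fun ξ η c => by
        rw [Finsupp.sum_smul_index' (by simp), Finsupp.mul_sum]
        refine Finsupp.sum_congr fun g _ => ?_
        rw [Finsupp.mul_sum]
        refine Finsupp.sum_congr fun h _ => ?_
        rw [smul_eq_mul, map_mul]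
        ring }
  let : SeminormedAddCommGroup (G →₀ ℂ) :=
    InnerProductSpace.Core.toSeminormedAddCommGroup (c := core)
  let : InnerProductSpace ℂ (G →₀ ℂ) := InnerProductSpace.ofCore core
  have inner_def : ∀ ξ η : G →₀ ℂ, ⟪ξ, η⟫_ℂ =
      ξ.sum fun g a => η.sum fun h b => conj a * (f (g⁻¹ * h) : ℂ) * b := fun _ _ => rfl
  have inner_map : ∀ (k : G) (ξ η : G →₀ ℂ),
      ⟪Finsupp.lmapDomain ℂ ℂ (k * ·) ξ, Finsupp.lmapDomain ℂ ℂ (k * ·) η⟫_ℂ = ⟪ξ, η⟫_ℂ :=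
    fun k ξ η => by
      rw [inner_def, inner_def, Finsupp.lmapDomain_apply, Finsupp.lmapDomain_apply,
        Finsupp.sum_mapDomain_index (by simp) (by simp [add_mul, Finsupp.sum_add])]
      refine Finsupp.sum_congr fun g _ => ?_
      rw [Finsupp.sum_mapDomain_index (by simp) (by simp [mul_add])]
      simp only [_root_.mul_inv_rev, mul_assoc, inv_mul_cancel_left]
  let L : G → (G →₀ ℂ) →L[ℂ] (G →₀ ℂ) := fun k =>
    ((Finsupp.lmapDomain ℂ ℂ (k * ·)).isometryOfInner (inner_map k)).toContinuousLinearMap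
  have L_apply : ∀ k ξ, L k ξ = Finsupp.mapDomain (k * ·) ξ := fun _ _ => rfl
  let U : G → Completion (G →₀ ℂ) →L[ℂ] Completion (G →₀ ℂ) := fun k => (L k).completion
  have U_coe : ∀ k (ξ : G →₀ ℂ), U k ξ = (L k ξ : Completion (G →₀ ℂ)) := fun k ξ =>
    ContinuousLinearMap.completion_apply_coe _ _
  have U_one : U 1 = 1 := by
    ext x
    induction x using Completion.induction_on with
    | hp => exact isClosed_eq (U 1).continuous continuous_id
    | ih ξ =>
      rw [U_coe, L_apply]
      simp only [one_mul]
      exact congrArg _ Finsupp.mapDomain_id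
  have U_mul : ∀ g h, U (g * h) = U g * U h := fun g h => by
    ext x
    induction x using Completion.induction_on with
    | hp => exact isClosed_eq (U (g * h)).continuous (U g * U h).continuous
    | ih ξ =>
      rw [mul_apply_eq_comp, U_coe, U_coe, U_coe, L_apply, L_apply, L_apply,
        ← Finsupp.mapDomain_comp]
      congr 2
      funext k
      exact mul_assoc g h k
  have U_star : ∀ g, star (U g) = U g⁻¹ := fun g => by
    refine Eq.symm ((ContinuousLinearMap.eq_adjoint_iff _ _).2 fun x y => ?_)
    induction x, y using Completion.induction_on₂ with
    | hp => exact isClosed_eq (by fun_prop) (by fun_prop)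
    | ih ξ η =>
      rw [U_coe, U_coe, Completion.inner_coe, Completion.inner_coe]
      have h := inner_map g (L g⁻¹ ξ) η
      have h' : Finsupp.lmapDomain ℂ ℂ (g * ·) (L g⁻¹ ξ) = ξ := by
        rw [Finsupp.lmapDomain_apply, L_apply, ← Finsupp.mapDomain_comp]
        convert Finsupp.mapDomain_id
        funext k
        exact mul_inv_cancel_left g k
      rw [h'] at h
      exact h.symm
  refine ⟨Completion (G →₀ ℂ), inferInstance, inferInstance, inferInstance,
    { toFun := fun g => ⟨U g, ?_⟩
      map_one' := Subtype.ext U_one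
      map_mul' := fun g h => Subtype.ext (U_mul g h) },
    ((Finsupp.single 1 1 : G →₀ ℂ) : Completion (G →₀ ℂ)), fun g => ?_⟩
  · rw [Unitary.mem_iff, U_star, ← U_mul, ← U_mul, inv_mul_cancel, mul_inv_cancel, U_one]
    exact ⟨rfl, rfl⟩
  · change ⟪_, U g _⟫_ℂ = _
    rw [U_coe, Completion.inner_coe, L_apply, Finsupp.mapDomain_single, inner_def,
      Finsupp.sum_single_index (by simp), Finsupp.sum_single_index (by simp)]
    simp

end GNS

/-! ### The real group algebra acting in unitary representations. -/

section RealRep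

open scoped InnerProductSpace

variable {G H : Type*} [Group G] [NormedAddCommGroup H] [InnerProductSpace ℂ H] [CompleteSpace H]

/-- The action of the real group algebra in a unitary representation. -/
noncomputable def realRep (π : G →* unitary (H →L[ℂ] H)) :
    MonoidAlgebra ℝ G →+* (H →L[ℂ] H) :=
  (repExtend π : MonoidAlgebra ℂ G →+* (H →L[ℂ] H)).comp
    (MonoidAlgebra.mapRingHom G Complex.ofRealHom)

variable (π : G →* unitary (H →L[ℂ] H))

theorem realRep_single (g : G) (a : ℝ) :
    realRep π (MonoidAlgebra.single g a) = (a : ℂ) • (π g : H →L[ℂ] H) := by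
  simp [realRep, repExtend]

theorem realRep_smul (c : ℝ) (ξ : MonoidAlgebra ℝ G) :
    realRep π (c • ξ) = (c : ℂ) • realRep π ξ := by
  induction ξ using MonoidAlgebra.induction_linear with
  | zero => simp
  | add ξ η hξ hη => rw [smul_add, map_add, map_add, hξ, hη, smul_add]
  | single g a =>
    rw [MonoidAlgebra.smul_single, realRep_single, realRep_single, smul_smul, smul_eq_mul,
      Complex.ofReal_mul]

theorem realRep_groupStar (ξ : MonoidAlgebra ℝ G) :
    realRep π (groupStar ξ) = star (realRep π ξ) := by
  induction ξ using MonoidAlgebra.induction_linear with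
  | zero => simp [groupStar_zero]
  | add ξ η hξ hη => rw [groupStar_add, map_add, map_add, hξ, hη, star_add]
  | single g a =>
    rw [groupStar_single, realRep_single, realRep_single, star_smul, map_inv]
    simp [← Unitary.star_eq_inv]

theorem inner_realRep {f : G → ℝ} {v : H} (hv : ∀ g, ⟪v, (π g : H →L[ℂ] H) v⟫_ℂ = (f g : ℂ))
    (ξ : MonoidAlgebra ℝ G) : ⟪v, realRep π ξ v⟫_ℂ = (pairing f ξ : ℂ) := by
  induction ξ using MonoidAlgebra.induction_linear with
  | zero => simp
  | add ξ η hξ hη =>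
    rw [map_add, add_apply, inner_add_right, hξ, hη, map_add,
      Complex.ofReal_add]
  | single g a =>
    rw [realRep_single, smul_apply, inner_smul_right, hv, pairing_single,
      Complex.ofReal_mul]

theorem inner_realRep_groupStar_mul_self (ξ : MonoidAlgebra ℝ G) (v : H) :
    (⟪v, realRep π (groupStar ξ * ξ) v⟫_ℂ).re = ‖realRep π ξ v‖ ^ 2 := by
  rw [map_mul, realRep_groupStar, mul_apply_eq_comp,
    ContinuousLinearMap.star_eq_adjoint, ContinuousLinearMap.adjoint_inner_right]
  exact inner_self_eq_norm_sq (𝕜 := ℂ) _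

theorem inner_realRep_nonneg_of_mem_sosCone {ξ : MonoidAlgebra ℝ G} (hξ : ξ ∈ sosCone ℝ G)
    (v : H) : 0 ≤ (⟪v, realRep π ξ v⟫_ℂ).re := by
  induction hξ using Submodule.span_induction with
  | mem x hx =>
    obtain ⟨η, rfl⟩ := hx
    rw [inner_realRep_groupStar_mul_self]
    positivity
  | zero => simp
  | add x y _ _ hx hy =>
    rw [map_add, add_apply, inner_add_right, Complex.add_re]
    exact add_nonneg hx hy
  | smul c x _ hx =>
    have h : c • x = (c : ℝ) • x := rfl
    rw [h, realRep_smul, smul_apply, inner_smul_right, Complex.re_ofReal_mul]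
    exact mul_nonneg c.2 hx

end RealRep

open scoped InnerProductSpace Topology in
/-- A hermitian element of the augmentation ideal which is positive in every unitary representation
becomes a sum of hermitian squares after adding a small multiple of the Laplacian. -/
theorem add_smul_edgeMap_mem_sosCone {G : Type u} [Group G] {w : G →₀ ℝ} (hw : ∀ g, 0 ≤ w g)
    (hgen : Subgroup.closure {x : G | w x ≠ 0} = ⊤) {x : MonoidAlgebra ℝ G}
    (hx : groupStar x = x) (hx₀ : augmentation ℝ G x = 0)
    (hpos : ∀ (H : Type u) [NormedAddCommGroup H] [InnerProductSpace ℂ H] [CompleteSpace H]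
      (π : G →* unitary (H →L[ℂ] H)) (v : H), 0 ≤ (⟪v, realRep π x v⟫_ℂ).re)
    {δ : ℝ} (hδ : 0 < δ) : x + δ • edgeMap ℝ G w ∈ sosCone ℝ G := by
  have he : groupStar (edgeMap ℝ G w) = edgeMap ℝ G w := by
    rw [edgeMap_eq, groupStar_sub, groupStar_sub, groupStar_smul, groupStar_one,
      groupStar_groupStar, sub_right_comm]
  have he₀ : augmentation ℝ G (edgeMap ℝ G w) = 0 := by
    rw [edgeMap_eq, map_sub, map_sub, map_smul, map_one, augmentation_groupStar, smul_eq_mul]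
    ring
  by_contra hmem
  obtain ⟨ψ, h₁, hinv, hψ, hψx, hψw⟩ := exists_condNegative_of_notMem_sosCone hw hgen
    (by rw [groupStar_add, groupStar_smul, hx, he])
    (by rw [map_add, map_smul, hx₀, he₀, smul_zero, add_zero]) hmem
  have hψe : pairing ψ (edgeMap ℝ G w) = -2 := by
    rw [edgeMap_eq, map_sub, map_sub, map_smul, pairing_groupStar hinv, hψw,
      MonoidAlgebra.one_def, pairing_single, h₁]
    norm_num
  rw [map_add, map_smul, hψe, smul_eq_mul] at hψx
  have hF : ∀ t : ℝ, 0 ≤ t → 0 ≤ pairing (fun g => Real.exp (-(t * ψ g))) x := fun t ht => by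
    obtain ⟨H, _, _, _, π, v, hv⟩ := exists_unitaryRep_of_posSemidef
      (f := fun g => Real.exp (-(t * ψ g))) (posSemidef_exp_neg h₁ hinv hψ ht)
    have h := hpos H π v
    rwa [inner_realRep π hv, Complex.ofReal_re] at h
  -- This function is nonnegative for `t ≥ 0` and vanishes at `0` because `x` has augmentation zero.
  -- Hence its derivative `-ψ(x)` is nonnegative, whereas separation gave `ψ(x) ≥ 2δ`.
  have hderiv : HasDerivAt (fun t : ℝ => pairing (fun g => Real.exp (-(t * ψ g))) x)
      (-pairing ψ x) 0 := by
    simp only [pairing_apply, Finsupp.sum, ← Finset.sum_neg_distrib]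
    refine HasDerivAt.fun_sum fun g _ => ?_
    have h := (((hasDerivAt_id (0 : ℝ)).mul_const (ψ g)).neg.exp).const_mul (x.coeff g)
    simpa using h
  have h0 : pairing (fun g => Real.exp (-(0 * ψ g))) x = 0 := by
    simpa [pairing_apply, augmentation_eq_sum] using hx₀
  have h := ge_of_tendsto hderiv.tendsto_slope_zero_right
    (eventually_nhdsWithin_of_forall fun t (ht : 0 < t) => by
      rw [h0, sub_zero, zero_add, smul_eq_mul]
      exact mul_nonneg (inv_nonneg.2 ht.le) (hF t ht.le))
  linarith

/-! ### Elementary properties of the Laplacian. -/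

section Laplacian

variable {G : Type*} [Group G] {μ : G →₀ ℝ}

theorem laplacian_eq (μ : G →₀ ℝ) : laplacian μ = 1 - .ofCoeff μ := by
  rw [laplacian]
  congr 1
  exact MonoidAlgebra.sum_coeff_single (.ofCoeff μ)

theorem edgeMap_eq_two_smul_laplacian (hsum : (μ.sum fun _ a => a) = 1)
    (hsymm : ∀ x, μ x⁻¹ = μ x) : edgeMap ℝ G μ = (2 : ℝ) • laplacian μ := by
  rw [laplacian_eq, edgeMap_probability hsum hsymm]

theorem groupStar_laplacian (hsymm : ∀ x, μ x⁻¹ = μ x) :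
    groupStar (laplacian μ) = laplacian μ := by
  rw [laplacian_eq, groupStar_sub, groupStar_one]
  congr 1
  ext g
  rw [groupStar_coeff]
  exact hsymm g

theorem augmentation_laplacian (hsum : (μ.sum fun _ a => a) = 1) :
    augmentation ℝ G (laplacian μ) = 0 := by
  rw [laplacian_eq, map_sub, map_one, augmentation_eq_sum, MonoidAlgebra.coeff_ofCoeff, hsum,
    sub_self]

theorem groupStar_laplacian_sq_sub (hsymm : ∀ x, μ x⁻¹ = μ x) (κ : ℝ) :
    groupStar (laplacian μ ^ 2 - κ • laplacian μ) = laplacian μ ^ 2 - κ • laplacian μ := by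
  rw [groupStar_sub, groupStar_smul, sq, groupStar_mul, groupStar_laplacian hsymm]

theorem augmentation_laplacian_sq_sub (hsum : (μ.sum fun _ a => a) = 1) (κ : ℝ) :
    augmentation ℝ G (laplacian μ ^ 2 - κ • laplacian μ) = 0 := by
  rw [map_sub, map_pow, map_smul, augmentation_laplacian hsum, smul_zero, sub_zero,
    zero_pow two_ne_zero]

end Laplacian

/-! ### The Laplacian in a representation, and invariant vectors. -/

section Representation

open scoped InnerProductSpace

variable {G H : Type*} [Group G] [NormedAddCommGroup H] [InnerProductSpace ℂ H] [CompleteSpace H]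
  {μ : G →₀ ℝ} (π : G →* unitary (H →L[ℂ] H))

theorem realRep_apply_of_invariant {w : H} (hw : ∀ g, (π g : H →L[ℂ] H) w = w)
    (ξ : MonoidAlgebra ℝ G) : realRep π ξ w = (augmentation ℝ G ξ : ℂ) • w := by
  induction ξ using MonoidAlgebra.induction_linear with
  | zero => simp
  | add ξ η hξ hη =>
    rw [map_add, add_apply, hξ, hη, map_add, Complex.ofReal_add, add_smul]
  | single g a => rw [realRep_single, smul_apply, hw, augmentation_single]

theorem inner_realRep_edgeLaplacian (g : G) (v : H) :
    (⟪v, realRep π (edgeLaplacian ℝ g) v⟫_ℂ).re = ‖(π g : H →L[ℂ] H) v - v‖ ^ 2 := by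
  rw [edgeLaplacian, inner_realRep_groupStar_mul_self, map_sub, map_one, realRep_single,
    Complex.ofReal_one, one_smul, norm_sub_rev]
  rfl

theorem inner_realRep_laplacian_sq_sub (hsymm : ∀ x, μ x⁻¹ = μ x) (κ : ℝ) (v : H) :
    (⟪v, realRep π (laplacian μ ^ 2 - κ • laplacian μ) v⟫_ℂ).re =
      ‖realRep π (laplacian μ) v‖ ^ 2 - κ * (⟪v, realRep π (laplacian μ) v⟫_ℂ).re := by
  have h : laplacian μ ^ 2 = groupStar (laplacian μ) * laplacian μ := by
    rw [groupStar_laplacian hsymm, sq]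
  rw [map_sub, sub_apply, inner_sub_right, Complex.sub_re, realRep_smul,
    smul_apply, inner_smul_right, Complex.re_ofReal_mul, h, inner_realRep_groupStar_mul_self]

theorem inner_realRep_edgeMap (hsum : (μ.sum fun _ a => a) = 1) (hsymm : ∀ x, μ x⁻¹ = μ x)
    (v : H) : (⟪v, realRep π (edgeMap ℝ G μ) v⟫_ℂ).re =
      2 * (⟪v, realRep π (laplacian μ) v⟫_ℂ).re := by
  rw [edgeMap_eq_two_smul_laplacian hsum hsymm, realRep_smul, smul_apply, inner_smul_right,
    Complex.re_ofReal_mul]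

theorem inner_realRep_laplacian_nonneg (hμ : ∀ x, 0 ≤ μ x) (hsum : (μ.sum fun _ a => a) = 1)
    (hsymm : ∀ x, μ x⁻¹ = μ x) (v : H) : 0 ≤ (⟪v, realRep π (laplacian μ) v⟫_ℂ).re := by
  have h := inner_realRep_nonneg_of_mem_sosCone π (edgeMap_mem hμ) v
  rw [inner_realRep_edgeMap π hsum hsymm] at h
  linarith

/-- The order unit inequality read off in a representation: the energy of `v` controls its
displacement by every `g`. -/
theorem norm_sub_sq_le_of_mem_sosCone (hsum : (μ.sum fun _ a => a) = 1)
    (hsymm : ∀ x, μ x⁻¹ = μ x) {C : ℝ} {g : G}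
    (h : C • edgeMap ℝ G μ - edgeLaplacian ℝ g ∈ sosCone ℝ G) (v : H) :
    ‖(π g : H →L[ℂ] H) v - v‖ ^ 2 ≤ C * (2 * (⟪v, realRep π (laplacian μ) v⟫_ℂ).re) := by
  have h' := inner_realRep_nonneg_of_mem_sosCone π h v
  rw [map_sub, sub_apply, inner_sub_right, Complex.sub_re,
    inner_realRep_edgeLaplacian, realRep_smul, smul_apply, inner_smul_right,
    Complex.re_ofReal_mul, inner_realRep_edgeMap π hsum hsymm] at h'
  linarith

theorem isSelfAdjoint_realRep {ξ : MonoidAlgebra ℝ G} (h : groupStar ξ = ξ) :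
    IsSelfAdjoint (realRep π ξ) := by
  rw [IsSelfAdjoint, ← realRep_groupStar, h]

/-- The restriction of a unitary representation to an invariant closed subspace. -/
theorem exists_subrepresentation (M : Submodule ℂ H) [CompleteSpace M]
    (hM : ∀ g, ∀ v ∈ M, (π g : H →L[ℂ] H) v ∈ M) :
    ∃ ρ : G →* unitary (M →L[ℂ] M),
      ∀ g (v : M), (((ρ g : M →L[ℂ] M) v : M) : H) = (π g : H →L[ℂ] H) v := by
  let U : G → M →L[ℂ] M := fun g =>
    ((π g : H →L[ℂ] H).comp M.subtypeL).codRestrict M fun v => hM g v v.2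
  have U_coe : ∀ g (v : M), (U g v : H) = (π g : H →L[ℂ] H) v := fun _ _ => rfl
  have U_one : U 1 = 1 := by
    ext v
    rw [U_coe, map_one]
    rfl
  have U_mul : ∀ g h, U (g * h) = U g * U h := fun g h => by
    ext v
    rw [mul_apply_eq_comp, U_coe, U_coe, U_coe, map_mul]
    rfl
  have U_star : ∀ g, star (U g) = U g⁻¹ := fun g => by
    refine Eq.symm ((ContinuousLinearMap.eq_adjoint_iff _ _).2 fun x y => ?_)
    rw [Submodule.coe_inner, Submodule.coe_inner, U_coe, U_coe, map_inv, ← Unitary.star_eq_inv,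
      Unitary.coe_star, ContinuousLinearMap.star_eq_adjoint,
      ContinuousLinearMap.adjoint_inner_left]
  refine ⟨{ toFun := fun g => ⟨U g, ?_⟩
            map_one' := Subtype.ext U_one
            map_mul' := fun g h => Subtype.ext (U_mul g h) }, fun g v => rfl⟩
  rw [Unitary.mem_iff, U_star, ← U_mul, ← U_mul, inv_mul_cancel, mul_inv_cancel, U_one]
  exact ⟨rfl, rfl⟩

/-- The subspace of invariant vectors of a unitary representation. -/
def invariantVectors : Submodule ℂ H where
  carrier := {w | ∀ g, (π g : H →L[ℂ] H) w = w}
  add_mem' hv hw g := by rw [map_add, hv g, hw g]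
  zero_mem' g := map_zero _
  smul_mem' c w hw g := by rw [map_smul, hw g]

theorem isClosed_invariantVectors : IsClosed (invariantVectors π : Set H) := by
  have h : (invariantVectors π : Set H) = ⋂ g, {w | (π g : H →L[ℂ] H) w = w} := by
    ext w
    simp only [Set.mem_iInter]
    rfl
  rw [h]
  exact isClosed_iInter fun g => isClosed_eq (π g : H →L[ℂ] H).continuous continuous_id

theorem apply_mem_orthogonal_invariantVectors (g : G) {v : H}
    (hv : v ∈ (invariantVectors π)ᗮ) : (π g : H →L[ℂ] H) v ∈ (invariantVectors π)ᗮ := by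
  intro w hw
  have h := hw g⁻¹
  rw [map_inv, ← Unitary.star_eq_inv, Unitary.coe_star, ContinuousLinearMap.star_eq_adjoint] at h
  rw [← ContinuousLinearMap.adjoint_inner_left, h]
  exact hv w hw

end Representation

/-! ### Property (T) and the spectral gap. -/

section PropertyT

open scoped InnerProductSpace

/-- Property (T) gives a spectral gap of the Laplacian in all unitary representations. -/
theorem KazhdanPropertyT.exists_gap {G : Type u} [Group G] (hT : KazhdanPropertyT G) {μ : G →₀ ℝ}
    (hμ : ∀ x, 0 ≤ μ x) (hsum : (μ.sum fun _ a => a) = 1) (hsymm : ∀ x, μ x⁻¹ = μ x)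
    (hgen : Subgroup.closure {x : G | μ x ≠ 0} = ⊤) :
    ∃ κ : ℝ, 0 < κ ∧ ∀ (H : Type u) [NormedAddCommGroup H] [InnerProductSpace ℂ H]
      [CompleteSpace H] (π : G →* unitary (H →L[ℂ] H)) (v : H),
      0 ≤ (⟪v, realRep π (laplacian μ ^ 2 - κ • laplacian μ) v⟫_ℂ).re := by
  obtain ⟨Q, ε, hε, hQ⟩ := hT
  choose C hC₀ hC using exists_smul_edgeMap_sub_mem hμ hgen
  -- A common bound for the `C g` over `Q`; the summand `1` keeps it positive.
  set B : ℝ := ∑ g ∈ Q, C g + 1 with hB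
  have hB₀ : 0 < B := by
    have := Finset.sum_nonneg fun g (_ : g ∈ Q) => hC₀ g
    linarith
  have hCB : ∀ g ∈ Q, C g ≤ B := fun g hg => by
    have := Finset.single_le_sum (fun g _ => hC₀ g) hg
    linarith
  refine ⟨ε ^ 2 / (2 * B), by positivity, fun H _ _ _ π v => ?_⟩
  set A := realRep π (laplacian μ) with hA
  have : CompleteSpace (invariantVectors π) := (isClosed_invariantVectors π).completeSpace_coe
  -- The orthogonal complement has no nonzero invariant vector, so by (T) some `g ∈ Q` moves `u` by
  -- at least `ε‖u‖`; squaring and using `C g ≤ B` gives the constant.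
  have hgap : ∀ u ∈ (invariantVectors π)ᗮ, ε ^ 2 / (2 * B) * ‖u‖ ^ 2 ≤ (⟪u, A u⟫_ℂ).re := by
    intro u hu
    obtain ⟨ρ, hρ⟩ := exists_subrepresentation π (invariantVectors π)ᗮ
      fun g v hv => apply_mem_orthogonal_invariantVectors π g hv
    rcases eq_or_ne u 0 with rfl | hu₀
    · simp
    have hnot : ¬ ∀ g ∈ Q, ‖(π g : H →L[ℂ] H) u - u‖ < ε * ‖u‖ := fun h => by
      obtain ⟨w, hw₀, hw⟩ := hQ _ ρ ⟨⟨u, hu⟩, by simpa using hu₀, fun g hg => by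
        have h' := h g hg
        rwa [← hρ g ⟨u, hu⟩] at h'⟩
      have hwinv : (w : H) ∈ invariantVectors π := fun g => by rw [← hρ, hw g]
      exact hw₀ (Subtype.ext ((Submodule.mem_bot ℂ).1
        ((invariantVectors π).inf_orthogonal_eq_bot ▸ ⟨hwinv, w.2⟩)))
    push Not at hnot
    obtain ⟨g, hg, hgu⟩ := hnot
    have h₁ := norm_sub_sq_le_of_mem_sosCone π hsum hsymm (hC g) u
    have h₂ := pow_le_pow_left₀ (by positivity) hgu 2
    have h₃ := inner_realRep_laplacian_nonneg π hμ hsum hsymm u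
    have h₄ := mul_le_mul_of_nonneg_right (hCB g hg) (mul_nonneg zero_le_two h₃)
    rw [div_mul_eq_mul_div, div_le_iff₀ (by positivity)]
    rw [mul_pow] at h₂
    linarith
  rw [inner_realRep_laplacian_sq_sub π hsymm, sub_nonneg]
  obtain ⟨v₀, hv₀, v₁, hv₁, rfl⟩ := (invariantVectors π).exists_add_mem_mem_orthogonal v
  have hAv₀ : A v₀ = 0 := by
    rw [hA, realRep_apply_of_invariant π hv₀, augmentation_laplacian hsum]
    simp
  have hadj : ContinuousLinearMap.adjoint A = A :=
    isSelfAdjoint_realRep π (groupStar_laplacian hsymm)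
  rw [← hA, map_add, hAv₀, zero_add, inner_add_left, ← ContinuousLinearMap.adjoint_inner_left A,
    hadj, hAv₀, inner_zero_left, zero_add]
  have h₁ := hgap v₁ hv₁
  have h₂ : (⟪v₁, A v₁⟫_ℂ).re ≤ ‖v₁‖ * ‖A v₁‖ := re_inner_le_norm (𝕜 := ℂ) v₁ (A v₁)
  have hκ : 0 < ε ^ 2 / (2 * B) := by positivity
  set κ := ε ^ 2 / (2 * B)
  rcases (norm_nonneg v₁).eq_or_lt with h | h
  · rw [← h, zero_mul] at h₂
    nlinarith [sq_nonneg ‖A v₁‖]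
  · have h₃ : κ * ‖v₁‖ ≤ ‖A v₁‖ := by
      refine le_of_mul_le_mul_left ?_ h
      linarith
    calc κ * (⟪v₁, A v₁⟫_ℂ).re ≤ κ * (‖v₁‖ * ‖A v₁‖) := mul_le_mul_of_nonneg_left h₂ hκ.le
      _ = κ * ‖v₁‖ * ‖A v₁‖ := by ring
      _ ≤ ‖A v₁‖ * ‖A v₁‖ := mul_le_mul_of_nonneg_right h₃ (norm_nonneg _)
      _ = ‖A v₁‖ ^ 2 := (sq _).symm

/-- An injective positive operator with `κA ≤ A²` is bounded below by `κ`. -/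
theorem ContinuousLinearMap.IsPositive.mul_norm_le_norm_apply {H : Type*} [NormedAddCommGroup H]
    [InnerProductSpace ℂ H] [CompleteSpace H] {A : H →L[ℂ] H} (hA : A.IsPositive) {κ : ℝ}
    (hκ : 0 ≤ κ) (hgap : ∀ u, κ * (⟪u, A u⟫_ℂ).re ≤ ‖A u‖ ^ 2) (hinj : ∀ u, A u = 0 → u = 0)
    (v : H) : κ * ‖v‖ ≤ ‖A v‖ := by
  have hA₀ : 0 ≤ A := ContinuousLinearMap.nonneg_iff_isPositive A |>.2 hA
  set B := CFC.sqrt A with hB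
  have hBB : ∀ u, B (B u) = A u := fun u =>
    congrArg (fun T : H →L[ℂ] H => T u) (CFC.sqrt_mul_sqrt_self A hA₀)
  have hadj : ContinuousLinearMap.adjoint B = B := (CFC.sqrt_nonneg A).isSelfAdjoint
  have hBsq : ∀ u, ‖B u‖ ^ 2 = (⟪u, A u⟫_ℂ).re := fun u => by
    rw [← hBB u, ← ContinuousLinearMap.adjoint_inner_left B, hadj]
    exact (inner_self_eq_norm_sq (𝕜 := ℂ) _).symm
  -- The hypothesis reads `κ‖y‖² ≤ ‖B y‖²` for `y` in the range of the square root `B`. That range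
  -- is dense since `B` is self-adjoint and injective, so the bound holds everywhere; applying it at
  -- `v` and then at `B v` gives the claim.
  have hdense : Dense (Set.range B) := by
    have h : B.range.topologicalClosure = ⊤ := by
      rw [Submodule.topologicalClosure_eq_top_iff, ContinuousLinearMap.orthogonal_range, hadj,
        LinearMap.ker_eq_bot']
      exact fun u hu => hinj u (by rw [← hBB u]; exact (congrArg B hu).trans (map_zero B))
    exact (Submodule.dense_iff_topologicalClosure_eq_top (s := B.range)).2 h
  have hlow : ∀ u, κ * ‖u‖ ^ 2 ≤ ‖B u‖ ^ 2 := fun u =>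
    hdense.induction (P := fun u => κ * ‖u‖ ^ 2 ≤ ‖B u‖ ^ 2)
      (by
        rintro _ ⟨u, rfl⟩
        rw [hBsq, hBB]
        exact hgap u)
      (isClosed_le (by fun_prop) (by fun_prop)) u
  refine (sq_le_sq₀ (by positivity) (norm_nonneg _)).1 ?_
  calc (κ * ‖v‖) ^ 2 = κ * (κ * ‖v‖ ^ 2) := by ring
    _ ≤ κ * ‖B v‖ ^ 2 := mul_le_mul_of_nonneg_left (hlow v) hκ
    _ ≤ ‖A v‖ ^ 2 := by rw [hBsq]; exact hgap v

/-- If `Δ² - κΔ` is a sum of hermitian squares with `κ > 0`, then the group has property (T). -/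
theorem kazhdanPropertyT_of_mem_sosCone {G : Type u} [Group G] {μ : G →₀ ℝ}
    (hμ : ∀ x, 0 ≤ μ x) (hsum : (μ.sum fun _ a => a) = 1) (hsymm : ∀ x, μ x⁻¹ = μ x)
    (hgen : Subgroup.closure {x : G | μ x ≠ 0} = ⊤) {κ : ℝ} (hκ : 0 < κ)
    (h : laplacian μ ^ 2 - κ • laplacian μ ∈ sosCone ℝ G) : KazhdanPropertyT G := by
  -- The Kazhdan pair is `(supp μ, κ)`: `A v` is the `μ`-average of the `v - π(x)v`, so a `(supp μ,
  -- κ)`-invariant vector violates `κ‖v‖ ≤ ‖A v‖`.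
  refine ⟨μ.support, κ, hκ, fun H _ _ _ π ⟨v, hv₀, hv⟩ => ?_⟩
  set A := realRep π (laplacian μ) with hA
  by_contra! hno
  have hpos : A.IsPositive := by
    refine ContinuousLinearMap.isPositive_def'.2
      ⟨isSelfAdjoint_realRep π (groupStar_laplacian hsymm), fun u => ?_⟩
    rw [ContinuousLinearMap.reApplyInnerSelf_apply, inner_re_symm]
    exact inner_realRep_laplacian_nonneg π hμ hsum hsymm u
  have hlow := hpos.mul_norm_le_norm_apply hκ.le (fun u => by
    have h' := inner_realRep_nonneg_of_mem_sosCone π h u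
    rw [inner_realRep_laplacian_sq_sub π hsymm] at h'
    -- A vector killed by `A` has zero energy, hence is fixed by every `g`.
    linarith) (fun u hu => by
      by_contra hu₀
      obtain ⟨g, hg⟩ := hno u hu₀
      obtain ⟨C, -, hC⟩ := exists_smul_edgeMap_sub_mem hμ hgen g
      have h' := norm_sub_sq_le_of_mem_sosCone π hsum hsymm hC u
      rw [← hA, hu, inner_zero_right, Complex.zero_re, mul_zero, mul_zero] at h'
      exact hg (sub_eq_zero.1 (norm_eq_zero.1 (pow_eq_zero_iff two_ne_zero |>.1
        (le_antisymm h' (sq_nonneg _)))))) v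
  refine hlow.not_gt ?_
  have hAv : A v = ∑ x ∈ μ.support, (μ x : ℂ) • (v - (π x : H →L[ℂ] H) v) := by
    have hsum' : ∑ x ∈ μ.support, (μ x : ℂ) = 1 := by
      rw [← Complex.ofReal_sum]
      exact_mod_cast hsum
    simp only [smul_sub, Finset.sum_sub_distrib, ← Finset.sum_smul]
    rw [hsum', one_smul, hA, laplacian, map_sub, map_one, sub_apply, Finsupp.sum,
      map_sum, sum_apply]
    simp only [realRep_single]
    rfl
  have hne : μ.support.Nonempty := by
    rw [Finsupp.support_nonempty_iff]
    rintro rfl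
    simp at hsum
  calc ‖A v‖ ≤ ∑ x ∈ μ.support, ‖(μ x : ℂ) • (v - (π x : H →L[ℂ] H) v)‖ := by
        rw [hAv]
        exact norm_sum_le _ _
    _ < ∑ x ∈ μ.support, μ x * (κ * ‖v‖) := by
        refine Finset.sum_lt_sum_of_nonempty hne fun x hx => ?_
        rw [norm_smul, Complex.norm_real, Real.norm_of_nonneg (hμ x), norm_sub_rev]
        exact mul_lt_mul_of_pos_left (hv x hx)
          ((hμ x).lt_of_ne (Ne.symm (Finsupp.mem_support_iff.1 hx)))
    _ = κ * ‖v‖ := by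
        rw [← Finset.sum_mul]
        exact (congrArg (· * (κ * ‖v‖)) hsum).trans (one_mul _)

end PropertyT

/-! ### Passage from real to rational squares. -/

theorem exists_sum_groupStar_mul_of_mem_sosCone {G : Type*} [Group G] {x : MonoidAlgebra ℝ G}
    (hx : x ∈ sosCone ℝ G) :
    ∃ (n : ℕ) (ξ : Fin n → MonoidAlgebra ℝ G), x = ∑ i, groupStar (ξ i) * ξ i := by
  obtain ⟨n, r, ξ, hr, rfl⟩ := exists_sum_of_mem_sosCone hx
  refine ⟨n, fun i => √(r i) • ξ i, Finset.sum_congr rfl fun i _ => ?_⟩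
  rw [groupStar_smul, smul_mul_smul_comm, Real.mul_self_sqrt (hr i).le]

/-- Rational approximation of a real solution of a system of quadratic equations. -/
theorem exists_rat_quadratic_approx {ι G : Type*} [Fintype ι] (S T : Finset G) (x c : G → ℝ)
    (E : G → G → G → ℝ) (a : ι → G → ℝ)
    (ha : ∀ k, x k = ∑ i, ∑ g ∈ S, ∑ h ∈ S, a i g * a i h * E g h k) {δ : ℝ} (hδ : 0 < δ) :
    ∃ q : ι → G → ℚ, ∑ k ∈ T, |-1 / 2 *
      (x k - ∑ i, ∑ g ∈ S, ∑ h ∈ S, (q i g : ℝ) * (q i h : ℝ) * E g h k)| * c k < δ := by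
  -- The error is continuous in the coefficients and vanishes at `a`; rational points are dense.
  have hdense : DenseRange (Pi.map fun _ : ι × G => ((↑) : ℚ → ℝ)) :=
    DenseRange.piMap fun _ => Rat.denseRange_cast
  have hcont : Continuous fun q : ι × G → ℝ => ∑ k ∈ T, |-1 / 2 *
      (x k - ∑ i, ∑ g ∈ S, ∑ h ∈ S, q (i, g) * q (i, h) * E g h k)| * c k := by
    fun_prop
  obtain ⟨q, hq⟩ := hdense.exists_mem_open (isOpen_lt hcont continuous_const)
    ⟨fun p => a p.1 p.2, by simpa [← ha] using hδ⟩
  exact ⟨fun i g => q (i, g), hq⟩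

section Rational

variable {K G : Type*} [Field K] [Group G]

/-- The element `∑ q(g) (g - 1)` of the augmentation ideal. -/
noncomputable def augmentationCombination (S : Finset G) (q : G → K) : MonoidAlgebra K G :=
  ∑ g ∈ S, q g • (MonoidAlgebra.single g 1 - 1)

theorem augmentation_augmentationCombination (S : Finset G) (q : G → K) :
    augmentation K G (augmentationCombination S q) = 0 := by
  simp [augmentationCombination, augmentation_single]

/-- The coefficients sum to zero, so they are also coordinates with respect to the `g - 1`. In these
coordinates any perturbation stays in the augmentation ideal. -/
theorem augmentationCombination_coeff {S : Finset G} {ξ : MonoidAlgebra K G}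
    (hS : ξ.coeff.support ⊆ S) (hξ : augmentation K G ξ = 0) :
    augmentationCombination S ξ.coeff = ξ := by
  have h₁ : ∑ g ∈ S, ξ.coeff g = 0 := by
    rw [← hξ, augmentation_eq_sum, Finsupp.sum_of_support_subset _ hS _ (by simp)]
  have h₂ : ∑ g ∈ S, MonoidAlgebra.single g (ξ.coeff g) = ξ := by
    conv_rhs => rw [← MonoidAlgebra.sum_coeff_single ξ]
    rw [Finsupp.sum_of_support_subset _ hS _ (by simp)]
  simp only [augmentationCombination, smul_sub, Finset.sum_sub_distrib, ← Finset.sum_smul, h₁,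
    zero_smul, sub_zero, MonoidAlgebra.smul_single, smul_eq_mul, mul_one, h₂]

theorem coeff_groupStar_augmentationCombination_mul (S : Finset G) (q : G → K) (k : G) :
    (groupStar (augmentationCombination S q) * augmentationCombination S q).coeff k =
      ∑ g ∈ S, ∑ h ∈ S, q g * q h *
        (groupStar (MonoidAlgebra.single g (1 : K) - 1) * (MonoidAlgebra.single h 1 - 1)).coeff k := by
  simp only [augmentationCombination, groupStar_sum, groupStar_smul, Finset.sum_mul_sum,
    smul_mul_smul_comm, MonoidAlgebra.coeff_sum, MonoidAlgebra.coeff_smul, Finsupp.finsetSum_apply,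
    Finsupp.smul_apply, smul_eq_mul]

/-- A rational hermitian element of the augmentation ideal which is a sum of hermitian squares
over `ℝ` becomes one over `ℚ` after adding a small multiple of the Laplacian. -/
theorem add_smul_edgeMap_mem_sosCone_rat {w : G →₀ ℚ} (hw : ∀ g, 0 ≤ w g)
    (hgen : Subgroup.closure {x : G | w x ≠ 0} = ⊤) {x : MonoidAlgebra ℚ G}
    (hx : groupStar x = x) (hx₀ : augmentation ℚ G x = 0)
    (hxs : MonoidAlgebra.mapRingHom G (Rat.castHom ℝ) x ∈ sosCone ℝ G) {δ : ℚ} (hδ : 0 < δ) :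
    x + δ • edgeMap ℚ G w ∈ sosCone ℚ G := by
  classical
  choose C hC₀ hC using exists_smul_edgeMap_sub_mem hw hgen
  obtain ⟨n, ξ, hξ⟩ := exists_sum_groupStar_mul_of_mem_sosCone hxs
  -- Augmentation turns the identity into `0 = ∑ ε(ξ i)²` in `ℝ`.
  have hξ₀ : ∀ i, augmentation ℝ G (ξ i) = 0 := by
    have h : augmentation ℝ G (MonoidAlgebra.mapRingHom G (Rat.castHom ℝ) x) = 0 := by
      have h' := congrArg (Rat.castHom ℝ) hx₀
      rw [augmentation_eq_sum, Finsupp.sum, map_sum, map_zero] at h'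
      rw [augmentation_eq_sum, Finsupp.sum_of_support_subset (s := x.coeff.support) _ _ _ (by simp)]
      · simpa using h'
      · intro g hg
        rw [Finsupp.mem_support_iff] at hg ⊢
        intro h0
        exact hg (by simp [h0])
    rw [hξ, map_sum] at h
    simp only [map_mul, augmentation_groupStar] at h
    exact fun i => mul_self_eq_zero.1
      ((Finset.sum_eq_zero_iff_of_nonneg fun i _ => mul_self_nonneg _).1 h i (Finset.mem_univ i))
  let S : Finset G := Finset.univ.biUnion fun i => (ξ i).coeff.support
  let E : G → G → MonoidAlgebra ℚ G := fun g h =>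
    groupStar (MonoidAlgebra.single g (1 : ℚ) - 1) * (MonoidAlgebra.single h 1 - 1)
  have hE : ∀ g h k, (groupStar (MonoidAlgebra.single g (1 : ℝ) - 1) *
      (MonoidAlgebra.single h 1 - 1)).coeff k = ((E g h).coeff k : ℝ) := fun g h k => by
    have h' : groupStar (MonoidAlgebra.single g (1 : ℝ) - 1) * (MonoidAlgebra.single h 1 - 1) =
        MonoidAlgebra.mapRingHom G (Rat.castHom ℝ) (E g h) := by
      rw [map_mul, ← groupStar_mapRingHom]
      simp
    rw [h', MonoidAlgebra.coeff_mapRingHom]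
    rfl
  let T : Finset G := x.coeff.support ∪
    S.biUnion fun g => S.biUnion fun h => (E g h).coeff.support
  have hξE : ∀ k, (x.coeff k : ℝ) =
      ∑ i, ∑ g ∈ S, ∑ h ∈ S, (ξ i).coeff g * (ξ i).coeff h * ((E g h).coeff k : ℝ) := fun k => by
    have h := congrArg (fun z : MonoidAlgebra ℝ G => z.coeff k) hξ
    simp only [MonoidAlgebra.coeff_mapRingHom, MonoidAlgebra.coeff_sum,
      Finsupp.finsetSum_apply] at h
    refine h.trans (Finset.sum_congr rfl fun i _ => ?_)
    have hi : augmentationCombination S (ξ i).coeff = ξ i :=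
      augmentationCombination_coeff (Finset.subset_biUnion_of_mem
        (fun i => (ξ i).coeff.support) (Finset.mem_univ i)) (hξ₀ i)
    conv_lhs => rw [← hi, coeff_groupStar_augmentationCombination_mul]
    simp only [hE]
  -- The error is measured in the weighted norm of `edgeMap_add_smul_mem`, with the factor `-1/2` of
  -- `edgeMap_coeff`; `T` contains the support of the remainder `z`.
  obtain ⟨q, hq⟩ := exists_rat_quadratic_approx S T (fun k => (x.coeff k : ℝ)) (fun k => (C k : ℝ))
    (fun g h k => ((E g h).coeff k : ℝ)) (fun i g => (ξ i).coeff g) hξE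
    (Rat.cast_pos.2 hδ : (0 : ℝ) < δ)
  let z : MonoidAlgebra ℚ G := x - ∑ i, groupStar (augmentationCombination S (q i)) *
    augmentationCombination S (q i)
  have hz_coeff : ∀ k, z.coeff k = x.coeff k -
      ∑ i, ∑ g ∈ S, ∑ h ∈ S, q i g * q i h * (E g h).coeff k := fun k => by
    simp only [z, MonoidAlgebra.coeff_sub, MonoidAlgebra.coeff_sum, Finsupp.sub_apply,
      Finsupp.finsetSum_apply, coeff_groupStar_augmentationCombination_mul]
    rfl
  have hz : groupStar z = z := by
    rw [groupStar_sub, groupStar_sum, hx]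
    simp only [groupStar_mul, groupStar_groupStar]
    rfl
  have hz₀ : augmentation ℚ G z = 0 := by
    simp [z, hx₀, augmentation_augmentationCombination]
  have hzT : ((-1 / 2 : ℚ) • z.coeff).support ⊆ T := by
    intro k hk
    by_contra hkT
    rw [Finset.mem_union, not_or, Finsupp.notMem_support_iff] at hkT
    refine Finsupp.mem_support_iff.1 hk ?_
    rw [Finsupp.smul_apply, hz_coeff, hkT.1, Finset.sum_eq_zero, sub_zero, smul_zero]
    refine fun i _ => Finset.sum_eq_zero fun g hg => Finset.sum_eq_zero fun h hh => ?_
    have h0 : (E g h).coeff k = 0 := by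
      by_contra hne
      exact hkT.2 (Finset.mem_biUnion.2 ⟨g, hg, Finset.mem_biUnion.2
        ⟨h, hh, Finsupp.mem_support_iff.2 hne⟩⟩)
    rw [h0, mul_zero]
  have hN : (((-1 / 2 : ℚ) • z.coeff).sum fun g a => |a| * C g) ≤ δ := by
    rw [Finsupp.sum_of_support_subset _ hzT _ (by simp)]
    refine le_of_lt (Rat.cast_lt (K := ℝ).1 (lt_of_eq_of_lt ?_ hq))
    simp only [Rat.cast_sum, Rat.cast_mul, Rat.cast_abs, Finsupp.smul_apply, smul_eq_mul,
      hz_coeff, Rat.cast_sub]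
    norm_num
  have hmem := edgeMap_add_smul_mem (edgeMap_mem hw) hC₀ hC ((-1 / 2 : ℚ) • z.coeff)
  rw [edgeMap_coeff hz hz₀] at hmem
  -- Less than `δ` of the order unit is spent on `z`; the rest is a nonnegative multiple of it.
  have hsum := add_mem (add_mem hmem (smul_mem_sosCone (sub_nonneg.2 hN) (edgeMap_mem hw)))
    (Submodule.sum_mem (sosCone ℚ G) fun i (_ : i ∈ Finset.univ) =>
      groupStar_mul_self_mem (augmentationCombination S (q i)))
  convert hsum using 1
  rw [add_assoc z, ← add_smul, add_sub_cancel, add_right_comm, sub_add_cancel]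

end Rational

/-! ### From the spectrum in the full group algebra to all representations. -/

section Spectrum

open scoped InnerProductSpace

/-- The extension of a unitary representation to the full group `C*`-algebra. -/
theorem exists_algHom_fullGroupCStarAlgebra {G H : Type u} [Group G] [NormedAddCommGroup H]
    [InnerProductSpace ℂ H] [CompleteSpace H] (π : G →* unitary (H →L[ℂ] H)) :
    ∃ Φ : FullGroupCStarAlgebra G →ₐ[ℂ] (H →L[ℂ] H),
      ∀ ξ : MonoidAlgebra ℝ G, Φ (toFullGroupCStarAlgebra ξ) = realRep π ξ := by
  let f : FullGroupAlgebra G →ₐ[ℂ] (H →L[ℂ] H) := repExtend π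
  have hf : Continuous f.toRingHom := AddMonoidHomClass.continuous_of_bound f 1 fun a =>
    (norm_le_fullNorm π a).trans_eq (one_mul _).symm
  let F : FullGroupCStarAlgebra G →+* (H →L[ℂ] H) :=
    UniformSpace.Completion.extensionHom f.toRingHom hf
  have hcoe : ∀ a : FullGroupAlgebra G, F a = f a :=
    fun a => UniformSpace.Completion.extensionHom_coe f.toRingHom hf a
  exact ⟨⟨F, fun c => (hcoe _).trans (f.commutes c)⟩, fun ξ => hcoe _⟩

noncomputable instance (G : Type u) [Group G] : NormedAlgebra ℂ (FullGroupCStarAlgebra G) where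
  norm_smul_le := norm_smul_le

/-- A gap in the spectrum of the Laplacian in the full group `C*`-algebra. -/
theorem exists_gap_of_spectrum {G : Type u} [Group G] {μ : G →₀ ℝ} (hsymm : ∀ x, μ x⁻¹ = μ x)
    {κ : ℝ} (hκ : 0 < κ)
    (hspec : ∀ z ∈ spectrum ℂ (toFullGroupCStarAlgebra (laplacian μ)),
      z = 0 ∨ ∃ t : ℝ, κ < t ∧ z = (t : ℂ)) :
    ∃ κ' : ℝ, κ < κ' ∧ ∀ (H : Type u) [NormedAddCommGroup H] [InnerProductSpace ℂ H]
      [CompleteSpace H] (π : G →* unitary (H →L[ℂ] H)) (v : H),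
      0 ≤ (⟪v, realRep π (laplacian μ ^ 2 - κ' • laplacian μ) v⟫_ℂ).re := by
  set S := spectrum ℂ (toFullGroupCStarAlgebra (laplacian μ)) with hS
  -- Compactness of the spectrum upgrades the open gap to one with room to spare; `κ + 1` serves if
  -- nothing lies beyond `κ`.
  obtain ⟨κ', hκ', hS'⟩ : ∃ κ', κ < κ' ∧ ∀ z ∈ S, κ ≤ z.re → κ' ≤ z.re := by
    have hcomp : IsCompact (S ∩ {z | κ ≤ z.re}) :=
      (spectrum.isCompact (𝕜 := ℂ) (toFullGroupCStarAlgebra (laplacian μ))).inter_right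
        (isClosed_le continuous_const Complex.continuous_re)
    rcases (S ∩ {z | κ ≤ z.re}).eq_empty_or_nonempty with h | h
    · exact ⟨κ + 1, lt_add_one κ, fun z hz hzκ => absurd (h ▸ ⟨hz, hzκ⟩ : z ∈ (∅ : Set ℂ)) id⟩
    · obtain ⟨z₀, hz₀, hmin⟩ := hcomp.exists_isMinOn h Complex.continuous_re.continuousOn
      refine ⟨z₀.re, ?_, fun z hz hzκ => hmin ⟨hz, hzκ⟩⟩
      rcases hspec z₀ hz₀.1 with h0 | ⟨t, ht, h0⟩
      · have h1 : κ ≤ z₀.re := hz₀.2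
        rw [h0, Complex.zero_re] at h1
        exact absurd hκ h1.not_gt
      · rwa [h0, Complex.ofReal_re]
  refine ⟨κ', hκ', fun H _ _ _ π v => ?_⟩
  obtain ⟨Φ, hΦ⟩ := exists_algHom_fullGroupCStarAlgebra π
  set A := realRep π (laplacian μ) with hA
  have hsa : IsSelfAdjoint A := isSelfAdjoint_realRep π (groupStar_laplacian hsymm)
  have hsub : spectrum ℂ A ⊆ S := by
    rw [hA, ← hΦ]
    exact AlgHom.spectrum_apply_subset Φ _
  -- The homomorphism `Φ` can only shrink the spectrum, so that of `A` lies in `{0} ∪ [κ', ∞)`,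
  -- where the polynomial is nonnegative.
  have hcfc : 0 ≤ cfc (fun t : ℝ => t ^ 2 - κ' * t) A := by
    refine cfc_nonneg fun t ht => ?_
    have ht' : (t : ℂ) ∈ S := hsub (spectrum.algebraMap_mem ℂ ht)
    rcases hspec _ ht' with h | ⟨s, hs, h⟩
    · rw [Complex.ofReal_eq_zero.1 h]
      simp
    · have h1 : κ' ≤ t := hS' _ ht' (by
        rw [Complex.ofReal_re, Complex.ofReal_injective h]
        exact hs.le)
      nlinarith
  have hA' : realRep π (laplacian μ ^ 2 - κ' • laplacian μ) =
      cfc (fun t : ℝ => t ^ 2 - κ' * t) A := by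
    rw [cfc_sub (fun t : ℝ => t ^ 2) (fun t : ℝ => κ' * t) A, cfc_pow_id A 2,
      cfc_const_mul_id κ' A, map_sub, map_pow, realRep_smul]
    rfl
  rw [hA']
  exact (ContinuousLinearMap.nonneg_iff_isPositive _ |>.1 hcfc).re_inner_nonneg_right v

end Spectrum

/-! ### Assembly of both statements. -/

theorem mainTheorem1 {G : Type u} [Group G] [Group.FG G] (μ : G →₀ ℝ)
    (hμ_nonneg : ∀ x, 0 ≤ μ x) (hμ_sum : (μ.sum fun _ a => a) = 1)
    (hμ_symm : ∀ x, μ x⁻¹ = μ x)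
    (hμ_gen : Subgroup.closure {x : G | μ x ≠ 0} = ⊤) :
    (KazhdanPropertyT G ↔
      ∃ (κ : ℝ) (n : ℕ) (ξ : Fin n → MonoidAlgebra ℝ G), 0 < κ ∧
        laplacian μ ^ 2 - κ • laplacian μ = ∑ i, groupStar (ξ i) * ξ i) ∧
    ((∀ x, ∃ q : ℚ, μ x = (q : ℝ)) → ∀ κ : ℚ, 0 < κ →
      (∀ z ∈ spectrum ℂ (toFullGroupCStarAlgebra (laplacian μ)),
        z = 0 ∨ ∃ t : ℝ, (κ : ℝ) < t ∧ z = (t : ℂ)) →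
      ∃ (n : ℕ) (r : Fin n → ℚ) (ξ : Fin n → MonoidAlgebra ℚ G), (∀ i, 0 < r i) ∧
        laplacian μ ^ 2 - (κ : ℝ) • laplacian μ =
          ∑ i, (r i : ℝ) • MonoidAlgebra.mapRingHom G (Rat.castHom ℝ)
            (groupStar (ξ i) * ξ i)) := by
  -- Lowering `κ'` to `κ` adds `(κ' - κ)Δ`, which is `δ • edgeMap ℝ G μ` for `δ = (κ' - κ)/2`.
  have hreal : ∀ {κ κ' : ℝ}, κ < κ' → (∀ (H : Type u) [NormedAddCommGroup H]
      [InnerProductSpace ℂ H] [CompleteSpace H] (π : G →* unitary (H →L[ℂ] H)) (v : H),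
      0 ≤ (inner ℂ v (realRep π (laplacian μ ^ 2 - κ' • laplacian μ) v)).re) →
      laplacian μ ^ 2 - κ • laplacian μ ∈ sosCone ℝ G := by
    intro κ κ' hκ hpos
    convert add_smul_edgeMap_mem_sosCone hμ_nonneg hμ_gen (groupStar_laplacian_sq_sub hμ_symm κ')
      (augmentation_laplacian_sq_sub hμ_sum κ') hpos (δ := (κ' - κ) / 2) (by linarith) using 1
    rw [edgeMap_eq_two_smul_laplacian hμ_sum hμ_symm, smul_smul, div_mul_cancel₀ _ two_ne_zero,
      sub_smul]
    abel
  refine ⟨⟨fun hT => ?_, ?_⟩, fun hrat κ hκ hspec => ?_⟩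
  · obtain ⟨κ, hκ, hpos⟩ := hT.exists_gap hμ_nonneg hμ_sum hμ_symm hμ_gen
    obtain ⟨n, ξ, h⟩ := exists_sum_groupStar_mul_of_mem_sosCone (hreal (half_lt_self hκ) hpos)
    exact ⟨κ / 2, n, ξ, half_pos hκ, h⟩
  · rintro ⟨κ, n, ξ, hκ, h⟩
    refine kazhdanPropertyT_of_mem_sosCone hμ_nonneg hμ_sum hμ_symm hμ_gen hκ ?_
    rw [h]
    exact Submodule.sum_mem _ fun i _ => groupStar_mul_self_mem (ξ i)
  · obtain ⟨κ₂, hκ₂, hpos⟩ := exists_gap_of_spectrum hμ_symm (by exact_mod_cast hκ) hspec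
    -- The gap is spent twice: from `κ₂` to `κ₁` for real squares, from `κ₁` to `κ` for rational
    -- ones. The second needs `Δ² - κ₁Δ` to be rational.
    obtain ⟨κ₁, hκκ₁, hκ₁⟩ := exists_rat_btwn hκ₂
    have hκκ₁ : κ < κ₁ := by exact_mod_cast hκκ₁
    have hmem := hreal hκ₁ hpos
    choose q hq using hrat
    have hq₀ : ∀ x, μ x = 0 ↔ q x = 0 := fun x => by rw [hq, Rat.cast_eq_zero]
    let ν : G →₀ ℚ := Finsupp.onFinset μ.support q fun x hx =>
      Finsupp.mem_support_iff.2 fun h => hx ((hq₀ x).1 h)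
    have hν : ∀ x, μ x = (ν x : ℝ) := hq
    have hν_sum : (ν.sum fun _ a => a) = 1 := by
      have h := hμ_sum
      rw [Finsupp.sum] at h
      rw [Finsupp.sum_of_support_subset (s := μ.support) ν Finsupp.support_onFinset_subset _
        (by simp)]
      simp only [hν] at h
      exact_mod_cast h
    have hν_symm : ∀ x, ν x⁻¹ = ν x := fun x => by
      have h := hμ_symm x
      rw [hν, hν] at h
      exact_mod_cast h
    have hν_nonneg : ∀ x, 0 ≤ ν x := fun x => by
      have h := hμ_nonneg x
      rw [hν] at h
      exact_mod_cast h
    have hν_gen : Subgroup.closure {x : G | ν x ≠ 0} = ⊤ := by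
      rw [← hμ_gen]
      congr 1
      ext x
      exact not_congr (hq₀ x).symm
    let Δ : MonoidAlgebra ℚ G := 1 - .ofCoeff ν
    have hΔ : MonoidAlgebra.mapRingHom G (Rat.castHom ℝ) Δ = laplacian μ := by
      rw [laplacian_eq, map_sub, map_one]
      congr 1
      ext x
      rw [MonoidAlgebra.coeff_mapRingHom]
      exact (hν x).symm
    have hmap_smul : ∀ (c : ℚ) (x : MonoidAlgebra ℚ G),
        MonoidAlgebra.mapRingHom G (Rat.castHom ℝ) (c • x) =
          (c : ℝ) • MonoidAlgebra.mapRingHom G (Rat.castHom ℝ) x := fun c x => by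
      ext g
      simp
    have hΔ_star : groupStar Δ = Δ := by
      rw [groupStar_sub, groupStar_one]
      congr 1
      ext g
      rw [groupStar_coeff]
      exact hν_symm g
    have hΔ₀ : augmentation ℚ G Δ = 0 := by
      rw [map_sub, map_one, augmentation_eq_sum, MonoidAlgebra.coeff_ofCoeff, hν_sum, sub_self]
    have hrat := add_smul_edgeMap_mem_sosCone_rat hν_nonneg hν_gen
      (x := Δ ^ 2 - κ₁ • Δ) (δ := (κ₁ - κ) / 2)
      (by rw [groupStar_sub, groupStar_smul, sq, groupStar_mul, hΔ_star])
      (by rw [map_sub, map_pow, map_smul, hΔ₀]; simp)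
      (by rwa [map_sub, map_pow, hmap_smul, hΔ]) (by linarith)
    rw [edgeMap_probability hν_sum hν_symm, smul_smul, div_mul_cancel₀ _ two_ne_zero, sub_smul,
      sub_add_sub_cancel] at hrat
    obtain ⟨n, r, ξ, hr, h⟩ := exists_sum_of_mem_sosCone hrat
    refine ⟨n, r, ξ, hr, ?_⟩
    have h' := congrArg (MonoidAlgebra.mapRingHom G (Rat.castHom ℝ)) h
    rw [map_sub, map_pow, hmap_smul, hΔ, map_sum] at h'
    rw [h']
    exact Finset.sum_congr rfl fun i _ => hmap_smul _ _
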